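/- Let $\mathcal G=(V,E)$ be a finite connected simple graph with $r=|V|\ge 2$ vertices, $N(i)$ the set of neighbours of $i$, $d_i=|N(i)|$, and let $\alpha>0$. Let $\Delta_{r-1}=\{x\in\mathbb R_{\ge 0}^V:\sum_i x_i=1\}$, and for $f\in C^2(\Delta_{r-1})$ put $$\tilde L f=\frac12\sum_{i,j\in V}\sigma_{ij}(x)\frac{\partial^2 f}{\partial x_i\partial x_j}+\sum_{i\in V}\frac{\alpha}{2}(1-rx_i)\frac{\partial f}{\partial x_i},$$ where $\sigma_{ii}(x)=x_i\sum_{j\in N(i)}x_j$, $\sigma_{ij}(x)=-x_ix_j$ if $i\sim j$, and $\sigma_{ij}(x)=0$ otherwise. This is the generator of the diffusion $dx_i=\sum_{j\in N(i)}\sqrt{x_ix_j}\,dB_{ij}+\frac{\alpha}{2}(1-rx_i)\,dt$ with independent standard Brownian motions $B_{ij}=-B_{ji}$. Let $\{\tilde T_t\}_{t\ge 0}$ be a strongly continuous Markov semigroup on $C(\Delta_{r-1})$ (that is, $\tilde T_t1=1$ and $\tilde T_tf\ge 0$ for $f\ge 0$) associated with this diffusion, that is, $$\tilde T_tf-f=\int_0^t\tilde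 T_s\tilde Lf\,ds\qquad\text{for all } f\in C^2(\Delta_{r-1}),\ t\ge 0,$$ and let $\{\tilde T_t^*\}$ be the adjoint semigroup on the set $\mathcal P(\Delta_{r-1})$ of probability measures with the weak topology, given by $\langle\tilde T_t^*\mu,f\rangle=\langle\mu,\tilde T_tf\rangle$. Then there is a unique stationary state $\nu_\alpha\in\mathcal P(\Delta_{r-1})$, that is, a unique probability measure with $\tilde T_t^*\nu_\alpha=\nu_\alpha$ for all $t\ge 0$. Moreover, for every $x\in\Delta_{r-1}$, $$\lim_{t\to\infty}\tilde T_t^*\delta_x=\nu_\alpha .$$ The moments of $\nu_\alpha$ are as follows. For $a\in\mathbb N_0^V$ let $(\tilde a(t),\tilde{\mathbf P}_a)$ be a (right-continuous) continuous-time Markov chain on $\mathbb N_0^V$ started at $a$ with rate matrix $$\tilde R_{b,b-e_i+e_j}=\frac{b_i(b_i-1)}{2}\ (i\in V,\ j\in N(i)),\qquad \tilde R_{b,b-e_i}=\frac{\alpha}{2}b_i\ (i\in V),$$ all other off-diagonal entries being $0$ and $\tilde R_{b,b}=-\sum_{c\ne b}\tilde R_{b,c}$. Let $\tau=\inf\{t>0:\tilde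 a(t)=0\}$ and $$\tilde k(b)=\sum_{i\in V}\sum_{j\in N(i)}\frac{b_ib_j}{2}+\frac{\alpha}{2}(r-1)\sum_{i\in V}b_i-\sum_{i\in V}\frac{d_ib_i(b_i-1)}{2}.$$ Then $\tau<\infty$ almost surely, the random variable $\exp\{-\int_0^\tau\tilde k(\tilde a(s))\,ds\}$ is integrable, and $$\int_{\Delta_{r-1}}\prod_{i\in V}x_i^{a_i}\,\nu_\alpha(dx)=\tilde{\mathbf E}_a\exp\Big\{-\int_0^\tau\tilde k(\tilde a(s))\,ds\Big\}.$$ -/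

import Mathlib

open MeasureTheory Filter Topology
open scoped NNReal ENNReal

noncomputable section

namespace GraphDiffusion

/-! ### Markov semigroups on `C(K)` and their adjoints -/

/-- A strongly continuous Markov semigroup `(T_t)_{t ≥ 0}` on `C(K, ℝ)`, `K` compact. -/
structure MarkovSemigroup (K : Type*) [TopologicalSpace K] [CompactSpace K] where
  /-- the operator at time `t` -/
  op : ℝ≥0 → C(K, ℝ) →L[ℝ] C(K, ℝ)
  op_zero : ∀ f, op 0 f = f
  op_add : ∀ s t f, op (s + t) f = op s (op t f)
  strongly_continuous : ∀ f, Continuous fun t => op t f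
  op_one : ∀ t, op t 1 = 1
  op_nonneg : ∀ t f, 0 ≤ f → 0 ≤ op t f

section Adjoint

variable {K : Type*} [TopologicalSpace K] [CompactSpace K] [T2Space K] [MeasurableSpace K]
  [BorelSpace K]

/-- The positive linear functional `f ↦ ∫ T_t f dμ`. -/
def MarkovSemigroup.functional (T : MarkovSemigroup K) (t : ℝ≥0) (μ : ProbabilityMeasure K) :
    CompactlySupportedContinuousMap K ℝ →ₚ[ℝ] ℝ :=
  PositiveLinearMap.mk₀
    { toFun := fun f => ∫ x, T.op t (f : C(K, ℝ)) x ∂(μ : Measure K)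
      map_add' := fun f g => by
        have h : ((f + g : CompactlySupportedContinuousMap K ℝ) : C(K, ℝ))
            = (f : C(K, ℝ)) + (g : C(K, ℝ)) := rfl
        rw [h, map_add]
        exact integral_add ((T.op t (f : C(K, ℝ))).continuous.integrable_of_hasCompactSupport
            (HasCompactSupport.of_compactSpace _))
          ((T.op t (g : C(K, ℝ))).continuous.integrable_of_hasCompactSupport
            (HasCompactSupport.of_compactSpace _))
      map_smul' := fun c f => by
        have h : ((c • f : CompactlySupportedContinuousMap K ℝ) : C(K, ℝ))
            = c • (f : C(K, ℝ)) := rfl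
        rw [h, map_smul]
        exact integral_const_mul c _ }
    (fun f hf => integral_nonneg fun x => T.op_nonneg t (f : C(K, ℝ)) (fun y => hf y) x)

/-- The adjoint semigroup `T_t^*` on probability measures: `T_t^* μ` is the measure that
represents `f ↦ ∫ T_t f dμ`. -/
def MarkovSemigroup.adjoint (T : MarkovSemigroup K) (t : ℝ≥0) (μ : ProbabilityMeasure K) :
    ProbabilityMeasure K :=
  ⟨RealRMK.rieszMeasure (T.functional t μ), by
    have h := RealRMK.integral_rieszMeasure (T.functional t μ)
      (CompactlySupportedContinuousMap.continuousMapEquiv (1 : C(K, ℝ)))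
    have h1 : T.functional t μ
        (CompactlySupportedContinuousMap.continuousMapEquiv (1 : C(K, ℝ))) = 1 := by
      change ∫ x, T.op t (1 : C(K, ℝ)) x ∂(μ : Measure K) = 1
      rw [T.op_one]
      simp
    rw [h1] at h
    change ∫ _, (1 : ℝ) ∂(RealRMK.rieszMeasure (T.functional t μ)) = 1 at h
    rw [integral_const, smul_eq_mul, mul_one] at h
    refine ⟨?_⟩
    rw [← ENNReal.ofReal_toReal (measure_ne_top (RealRMK.rieszMeasure (T.functional t μ)) _)]
    change ENNReal.ofReal ((RealRMK.rieszMeasure (T.functional t μ)).real Set.univ) = 1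
    rw [h, ENNReal.ofReal_one]⟩

/-- The duality `⟨T_t^* μ, f⟩ = ⟨μ, T_t f⟩`. -/
theorem MarkovSemigroup.integral_adjoint (T : MarkovSemigroup K) (t : ℝ≥0)
    (μ : ProbabilityMeasure K) (f : C(K, ℝ)) :
    ∫ x, f x ∂(T.adjoint t μ : Measure K) = ∫ x, T.op t f x ∂(μ : Measure K) :=
  RealRMK.integral_rieszMeasure (T.functional t μ)
    (CompactlySupportedContinuousMap.continuousMapEquiv f)

/-- A stationary state: a fixed point of the adjoint semigroup. -/
def MarkovSemigroup.IsStationary (T : MarkovSemigroup K) (μ : ProbabilityMeasure K) : Prop :=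
  ∀ t, T.adjoint t μ = μ

end Adjoint

/-! ### The generator of the diffusion with linear drift -/

section Diffusion

variable {V : Type*} [Fintype V] [DecidableEq V] (G : SimpleGraph V) [DecidableRel G.Adj]

/-- The diffusion matrix `σ_{ij}(x)`. -/
def sigma (i j : V) (x : V → ℝ) : ℝ :=
  if i = j then x i * ∑ k ∈ G.neighborFinset i, x k
  else if G.Adj i j then -(x i * x j) else 0

/-- The drift `(α / 2) (1 - r x_i)`, `r = |V|`. -/
def drift (α : ℝ) (i : V) (x : V → ℝ) : ℝ :=
  α / 2 * (1 - (Fintype.card V : ℝ) * x i)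

/-- The partial derivative `∂f / ∂x_i`. -/
def partialDeriv (i : V) (f : (V → ℝ) → ℝ) (x : V → ℝ) : ℝ :=
  fderiv ℝ f x (Pi.single i 1)

/-- `L f = (1/2) ∑_{i,j} σ_{ij} ∂²f/∂x_i∂x_j + ∑_i (α/2)(1 - r x_i) ∂f/∂x_i`. -/
def generatorFun (α : ℝ) (f : (V → ℝ) → ℝ) (x : V → ℝ) : ℝ :=
  1 / 2 * ∑ i, ∑ j, sigma G i j x * partialDeriv i (partialDeriv j f) x
    + ∑ i, drift α i x * partialDeriv i f x

theorem continuous_generatorFun (α : ℝ) {f : (V → ℝ) → ℝ} (hf : ContDiff ℝ 2 f) :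
    Continuous (generatorFun G α f) := by
  have h1 : ∀ j, ContDiff ℝ 1 (partialDeriv j f) := fun j =>
    (hf.fderiv_right (m := 1) (by norm_num)).clm_apply contDiff_const
  have h2 : ∀ i j, Continuous (partialDeriv i (partialDeriv j f)) := fun i j =>
    ((h1 j).continuous_fderiv (by norm_num)).clm_apply continuous_const
  have h3 : ∀ i j, Continuous (sigma G i j) := by
    intro i j
    unfold sigma
    split_ifs <;> fun_prop
  have h4 : ∀ i, Continuous (drift (V := V) α i) := by
    intro i
    unfold drift
    fun_prop
  unfold generatorFun
  exact (continuous_const.mul (continuous_finsetSum _ fun i _ => continuous_finsetSum _ fun j _ =>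
    (h3 i j).mul (h2 i j))).add
      (continuous_finsetSum _ fun i _ => (h4 i).mul (h1 i).continuous)

variable (V) in
/-- The simplex `Δ_{r-1}` of probability vectors on `V`. -/
abbrev Simplex : Type _ := ↥(stdSimplex ℝ V)

/-- Restriction of a continuous function on `ℝ^V` to the simplex. -/
def restrict (f : (V → ℝ) → ℝ) (hf : Continuous f) : C(Simplex V, ℝ) :=
  ⟨fun x => f x, hf.comp continuous_subtype_val⟩

/-- `T` is a Markov semigroup of the diffusion with linear drift on `G`:
`T_t f - f = ∫_0^t T_s L f ds` for every `f` of class `C²` on the simplex, such an `f` being the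
restriction of a `C²` function on `ℝ^V`. (On the simplex `L f` depends only on this restriction,
since `∑_j σ_{ij} = 0` and the drifts sum to zero there.) -/
def IsDiffusionSemigroup (α : ℝ) (T : MarkovSemigroup (Simplex V)) : Prop :=
  ∀ (f : (V → ℝ) → ℝ) (hf : ContDiff ℝ 2 f) (t : ℝ≥0),
    T.op t (restrict f hf.continuous) - restrict f hf.continuous
      = ∫ s in (0 : ℝ)..t,
          T.op s.toNNReal (restrict (generatorFun G α f) (continuous_generatorFun G α hf))

/-! ### The dual Markov chain on `ℕ^V` -/

/-- The off-diagonal rates: `a → a - e_i + e_j` at rate `a_i (a_i - 1) / 2` for `j ∈ N(i)`, and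
`a → a - e_i` at rate `α a_i / 2`. Both rates vanish if `a_i = 0`. -/
def jumpRate (α : ℝ) (a b : V → ℕ) : ℝ :=
  (∑ i, ∑ j ∈ G.neighborFinset i,
      if b + Pi.single i 1 = a + Pi.single j 1 then (a i : ℝ) * ((a i : ℝ) - 1) / 2 else 0)
    + ∑ i, if b + Pi.single i 1 = a then α / 2 * (a i : ℝ) else 0

/-- The rate matrix of the dual chain. -/
def rateMatrix (α : ℝ) (a b : V → ℕ) : ℝ :=
  if a = b then -∑ᶠ (c : V → ℕ) (_ : c ≠ a), jumpRate G α a c else jumpRate G α a b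

/-- The killing rate
`∑_i ∑_{j ∈ N(i)} a_i a_j / 2 + (α/2)(r - 1)|a| - ∑_i d_i a_i (a_i - 1) / 2`. -/
def killingRate (α : ℝ) (a : V → ℕ) : ℝ :=
  (∑ i, ∑ j ∈ G.neighborFinset i, (a i : ℝ) * (a j : ℝ) / 2)
    + α / 2 * ((Fintype.card V : ℝ) - 1) * ∑ i, (a i : ℝ)
    - ∑ i, (G.degree i : ℝ) * (a i : ℝ) * ((a i : ℝ) - 1) / 2

end Diffusion

/-! ### Continuous-time Markov chains on a discrete state space -/

section Chain

variable {S : Type*} [DecidableEq S]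

/-- `p` is a (stochastic) transition function on `S` with rate matrix `R`:
`R_{ab} = lim_{t ↓ 0} (p_t(a,b) - δ_{ab}) / t`. -/
structure IsTransitionFunction (R : S → S → ℝ) (p : ℝ≥0 → S → S → ℝ) : Prop where
  nonneg : ∀ t a b, 0 ≤ p t a b
  hasSum_one : ∀ t a, HasSum (fun b => p t a b) 1
  zero : ∀ a b, p 0 a b = if a = b then 1 else 0
  chapman_kolmogorov : ∀ s t a b, HasSum (fun c => p s a c * p t c b) (p (s + t) a b)
  rate : ∀ a b, Tendsto (fun t : ℝ≥0 => (p t a b - if a = b then 1 else 0) / (t : ℝ))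
    (𝓝[>] 0) (𝓝 (R a b))

variable {Ω : Type*} [MeasurableSpace Ω]

/-- Under the probability measure `P`, `X` is a continuous-time Markov chain with rate matrix `R`
started at `a`: its paths are right-continuous (for the discrete topology of `S`) and its
finite-dimensional distributions are those of a transition function with rate matrix `R`. -/
structure IsMarkovChain (R : S → S → ℝ) (a : S) (P : Measure Ω) (X : ℝ≥0 → Ω → S) : Prop where
  measurable : ∀ t b, MeasurableSet {ω | X t ω = b}
  right_continuous : ∀ ω t, ∀ᶠ s in 𝓝[≥] t, X s ω = X t ω
  markov : ∃ p : ℝ≥0 → S → S → ℝ, IsTransitionFunction R p ∧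
    ∀ (n : ℕ) (t : ℕ → ℝ≥0) (b : ℕ → S), t 0 = 0 → Monotone t →
      P {ω | ∀ k ≤ n, X (t k) ω = b k}
        = ENNReal.ofReal ((if b 0 = a then 1 else 0)
            * ∏ k ∈ Finset.range n, p (t (k + 1) - t k) (b k) (b (k + 1)))

/-- The hitting time `inf {t > 0 : X_t = c}`, with value `∞` if `c` is never hit. -/
def hittingTime (X : ℝ≥0 → Ω → S) (c : S) (ω : Ω) : ℝ≥0∞ :=
  sInf ((fun t : ℝ≥0 => (t : ℝ≥0∞)) '' {t : ℝ≥0 | 0 < t ∧ X t ω = c})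

end Chain

end GraphDiffusion

end

/-! The proof is by moment duality. Applied to a monomial, the generator gives `L x^a = ∑_b K_{ab}
x^b` with `K = R - diag k` (`generatorFun_monomialFun`). The rates never raise the degree, so on the
finite set of multi-indices of degree at most `N` this is a closed linear system, and `T_t x^a = ∑_b
exp(tK)_{ab} x^b` (`op_monomialMap`).

The matrix `K` has nonnegative off-diagonal entries, its row at `0` vanishes, and `0` is reachable
from every state by deletions. All terms of the duality formula are nonnegative on the simplex and
`T_t x^a ≤ 1`, so `exp(tK)_{a0}` is bounded. It is also nondecreasing in `t`, hence converges to
some `M a`. Weight staying at `b ≠ 0` would keep feeding column `0`, so the other columns tend to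
`0` (`exists_tendsto_exp_smul`). Therefore `T_t x^a → M a` whatever the initial law. Moments
determine measures on the simplex (Stone–Weierstrass), and compactness of the space of probability
measures then yields the limit `ν`, convergence to it, and uniqueness.

To identify `M a`, the Feynman–Kac formula (`IsMarkovChain.feynmanKac`) writes `exp(tK)_{a0}` as the
expectation of `exp(-∫_0^t k)` on `{X_t = 0}`. It follows from Chernoff's product formula by
sampling the chain on a grid. Since `0` is absorbing and `k 0 = 0`, the integral may be stopped at
`τ`, and `t → ∞` gives the moment formula. The killing rate can be negative, so integrability is a
real issue; it comes from Fatou's lemma and the convergence of `exp(tK)_{a0}`. -/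

noncomputable section

namespace GraphDiffusion

/-! ### Chernoff's product formula in a Banach algebra -/

section Chernoff

/-- Telescoping, with one factor exchanged at a time; `x` and `y` need not commute. -/
theorem norm_pow_sub_pow_le {A : Type*} [NormedRing A] [NormOneClass A] {M : ℝ} {x y : A}
    (hM : 1 ≤ M) (hx : ‖x‖ ≤ M) (hy : ‖y‖ ≤ M) (n : ℕ) :
    ‖x ^ n - y ^ n‖ ≤ n * M ^ n * ‖x - y‖ := by
  induction n with
  | zero => simp
  | succ n ih =>
    have h : x ^ (n + 1) - y ^ (n + 1) = x ^ n * (x - y) + (x ^ n - y ^ n) * y := by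
      rw [pow_succ, pow_succ]; noncomm_ring
    have hM0 : 0 ≤ M := zero_le_one.trans hM
    have h1 : ‖x ^ n * (x - y)‖ ≤ M ^ (n + 1) * ‖x - y‖ := by
      refine (norm_mul_le _ _).trans (mul_le_mul_of_nonneg_right ?_ (norm_nonneg _))
      exact (norm_pow_le _ _).trans ((pow_le_pow_left₀ (norm_nonneg _) hx n).trans
        (pow_le_pow_right₀ hM n.le_succ))
    have h2 : ‖(x ^ n - y ^ n) * y‖ ≤ n * M ^ n * ‖x - y‖ * M :=
      (norm_mul_le _ _).trans (mul_le_mul ih hy (norm_nonneg _) (by positivity))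
    rw [h]
    refine (norm_add_le _ _).trans ((add_le_add h1 h2).trans (le_of_eq ?_))
    push_cast
    ring

theorem eventually_norm_le_exp {A : Type*} [NormedRing A] [NormOneClass A] [NormedAlgebra ℝ A]
    {q : ℝ → A} {B : A} (hq : Tendsto (fun h => h⁻¹ • (q h - 1)) (𝓝[>] 0) (𝓝 B)) :
    ∀ᶠ h in 𝓝[>] (0 : ℝ), ‖q h‖ ≤ Real.exp ((‖B‖ + 1) * h) := by
  filter_upwards [hq.norm.eventually (gt_mem_nhds (lt_add_one ‖B‖)), self_mem_nhdsWithin]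
    with h h1 (h0 : 0 < h)
  have h2 : q h = 1 + h • (h⁻¹ • (q h - 1)) := by
    rw [smul_inv_smul₀ h0.ne']; abel
  calc ‖q h‖ ≤ ‖(1 : A)‖ + ‖h • (h⁻¹ • (q h - 1))‖ := by
        conv_lhs => rw [h2]
        exact norm_add_le _ _
    _ ≤ 1 + h * (‖B‖ + 1) := by
        rw [norm_one, norm_smul, Real.norm_of_nonneg h0.le]
        gcongr
    _ ≤ Real.exp ((‖B‖ + 1) * h) := by
        rw [add_comm, mul_comm]; exact Real.add_one_le_exp _

theorem tendsto_inv_smul_exp_sub_one {A : Type*} [NormedRing A] [NormedAlgebra ℝ A]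
    [CompleteSpace A] (B : A) :
    Tendsto (fun h : ℝ => h⁻¹ • (NormedSpace.exp (h • B) - 1)) (𝓝[>] 0) (𝓝 B) := by
  have h := (hasDerivAt_exp_smul_const' (𝕂 := ℝ) B 0).tendsto_slope_zero_right
  simpa using h

/-- **Chernoff's product formula** for a bounded generator. -/
theorem tendsto_pow_exp {A : Type*} [NormedRing A] [NormOneClass A] [NormedAlgebra ℝ A]
    [CompleteSpace A] {q : ℝ → A} {B : A}
    (hq : Tendsto (fun h => h⁻¹ • (q h - 1)) (𝓝[>] 0) (𝓝 B)) {t : ℝ} (ht : 0 < t) :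
    Tendsto (fun n : ℕ => q (t / n) ^ n) atTop (𝓝 (NormedSpace.exp (t • B))) := by
  have hlim : Tendsto (fun n : ℕ => t / (n : ℝ)) atTop (𝓝[>] 0) := by
    refine tendsto_nhdsWithin_iff.2 ⟨tendsto_const_div_atTop_nhds_zero_nat t, ?_⟩
    filter_upwards [eventually_gt_atTop 0] with n hn
    exact div_pos ht (Nat.cast_pos.2 hn)
  have he := tendsto_inv_smul_exp_sub_one B
  have hdiff : Tendsto (fun h : ℝ => h⁻¹ • (q h - NormedSpace.exp (h • B))) (𝓝[>] 0) (𝓝 0) := by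
    have := hq.sub he
    rw [sub_self] at this
    refine this.congr fun h => ?_
    rw [← smul_sub]
    congr 1
    abel
  -- The bound of `norm_pow_sub_pow_le` with `M = exp((‖B‖ + 1) t / n)`: `M ^ n` does not depend on
  -- `n`, and the factor `n` is `t` times the inverse of the step `t / n`.
  have hbound : Tendsto (fun n : ℕ => Real.exp ((‖B‖ + 1) * t) * t *
      ‖(t / (n : ℝ))⁻¹ • (q (t / n) - NormedSpace.exp ((t / (n : ℝ)) • B))‖) atTop (𝓝 0) := by
    have := ((hdiff.comp hlim).norm).const_mul (Real.exp ((‖B‖ + 1) * t) * t)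
    simpa using this
  rw [tendsto_iff_norm_sub_tendsto_zero]
  refine squeeze_zero' (Eventually.of_forall fun _ => norm_nonneg _) ?_ hbound
  filter_upwards [hlim.eventually (eventually_norm_le_exp hq),
    hlim.eventually (eventually_norm_le_exp he), eventually_gt_atTop 0] with n h1 h2 hn
  have hn' : (0 : ℝ) < n := Nat.cast_pos.2 hn
  have hexp : NormedSpace.exp (t • B) = NormedSpace.exp ((t / (n : ℝ)) • B) ^ n := by
    let _ : NormedAlgebra ℚ A := NormedAlgebra.restrictScalars ℚ ℝ A
    rw [← NormedSpace.exp_nsmul, ← Nat.cast_smul_eq_nsmul ℝ, smul_smul, mul_div_cancel₀ _ hn'.ne']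
  rw [hexp]
  refine (norm_pow_sub_pow_le (Real.one_le_exp (by positivity)) h1 h2 n).trans (le_of_eq ?_)
  rw [← Real.exp_nat_mul, norm_smul, Real.norm_of_nonneg (by positivity)]
  have h3 : (n : ℝ) * ((‖B‖ + 1) * (t / n)) = (‖B‖ + 1) * t := by field_simp
  rw [h3]
  field_simp

end Chernoff

/-! ### Exponentials of Metzler matrices with an absorbing state -/

section MetzlerMatrix

open scoped Matrix.Norms.Operator

variable {ι : Type*} [Fintype ι] [DecidableEq ι]

theorem exp_smul_add (A : Matrix ι ι ℝ) (s t : ℝ) :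
    NormedSpace.exp ((s + t) • A) = NormedSpace.exp (s • A) * NormedSpace.exp (t • A) := by
  rw [add_smul, Matrix.exp_add_of_commute]
  exact ((Commute.refl A).smul_left s).smul_right t

theorem hasDerivAt_exp_smul_apply (A : Matrix ι ι ℝ) (t : ℝ) (i j : ι) :
    HasDerivAt (fun t : ℝ => NormedSpace.exp (t • A) i j) ((A * NormedSpace.exp (t • A)) i j) t :=
  (LinearMap.toContinuousLinearMap (Matrix.entryLinearMap ℝ ℝ i j)).hasFDerivAt.comp_hasDerivAt t
    (hasDerivAt_exp_smul_const' (𝕂 := ℝ) A t)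

theorem pow_nonneg_entries {M : Matrix ι ι ℝ} (h : ∀ i j, 0 ≤ M i j) (n : ℕ) (i j : ι) :
    0 ≤ (M ^ n) i j := by
  induction n generalizing i j with
  | zero => rw [pow_zero, Matrix.one_apply]; split_ifs <;> norm_num
  | succ n ih =>
    rw [pow_succ, Matrix.mul_apply]
    exact Finset.sum_nonneg fun k _ => mul_nonneg (ih i k) (h k j)

/-- The exponential of a matrix with nonnegative off-diagonal entries is nonnegative. -/
theorem exp_smul_nonneg [Nonempty ι] {A : Matrix ι ι ℝ} (hA : ∀ i j, i ≠ j → 0 ≤ A i j) {t : ℝ}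
    (ht : 0 ≤ t) (i j : ι) : 0 ≤ NormedSpace.exp (t • A) i j := by
  rcases ht.eq_or_lt with rfl | ht
  · rw [zero_smul, NormedSpace.exp_zero, Matrix.one_apply]; split_ifs <;> norm_num
  -- Euler's approximation `(1 + (t/n) A)^n`: for large `n` the diagonal of the base is nonnegative
  -- too, hence so are all entries of the power.
  have hq : Tendsto (fun h : ℝ => h⁻¹ • ((1 + h • A) - 1)) (𝓝[>] 0) (𝓝 A) := by
    refine tendsto_const_nhds.congr' ?_
    filter_upwards [self_mem_nhdsWithin] with h (h0 : 0 < h)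
    rw [add_sub_cancel_left, inv_smul_smul₀ h0.ne']
  have h1 := tendsto_pow_exp hq ht
  have h2 : Tendsto (fun n : ℕ => ((1 + (t / (n : ℝ)) • A) ^ n) i j) atTop
      (𝓝 (NormedSpace.exp (t • A) i j)) :=
    ((continuous_id.matrix_elem i j).tendsto _).comp h1
  have h3 : ∀ k, ∀ᶠ n : ℕ in atTop, 0 ≤ 1 + t / (n : ℝ) * A k k := by
    intro k
    have : Tendsto (fun n : ℕ => 1 + t / (n : ℝ) * A k k) atTop (𝓝 (1 + 0 * A k k)) :=
      ((tendsto_const_div_atTop_nhds_zero_nat t).mul_const _).const_add _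
    rw [zero_mul, add_zero] at this
    exact (this.eventually (lt_mem_nhds one_pos)).mono fun _ h => h.le
  refine ge_of_tendsto h2 ?_
  filter_upwards [eventually_all.2 h3] with n hn
  refine pow_nonneg_entries (fun k l => ?_) n i j
  rw [Matrix.add_apply, Matrix.smul_apply, smul_eq_mul]
  by_cases hkl : k = l
  · subst hkl
    rw [Matrix.one_apply_eq]
    exact hn k
  · rw [Matrix.one_apply_ne hkl, zero_add]
    exact mul_nonneg (by positivity) (hA k l hkl)

theorem exp_smul_absorbing {A : Matrix ι ι ℝ} {z : ι} (hz : ∀ j, A z j = 0) (t : ℝ) (j : ι) :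
    NormedSpace.exp (t • A) z j = (1 : Matrix ι ι ℝ) z j := by
  have h : ∀ t, HasDerivAt (fun t : ℝ => NormedSpace.exp (t • A) z j) 0 t := by
    intro t
    have := hasDerivAt_exp_smul_apply A t z j
    rwa [Matrix.mul_apply, Finset.sum_eq_zero fun k _ => by rw [hz, zero_mul]] at this
  have := is_const_of_deriv_eq_zero (fun t => (h t).differentiableAt) (fun t => (h t).deriv) t 0
  simpa using this

/-- Induction on the rank `ρ`: a short time step from `b` to some `c` of lower rank has positive
weight because its derivative at time `0` is `A b c > 0`; the induction hypothesis leads from `c` to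
`z`. -/
theorem exists_exp_smul_pos [Nonempty ι] {A : Matrix ι ι ℝ} (hA : ∀ i j, i ≠ j → 0 ≤ A i j) {z : ι}
    (ρ : ι → ℕ) (hρ : ∀ b, b ≠ z → ∃ c, ρ c < ρ b ∧ 0 < A b c) (b : ι) :
    ∃ s : ℝ≥0, 0 < NormedSpace.exp ((s : ℝ) • A) b z := by
  induction hn : ρ b using Nat.strong_induction_on generalizing b with
  | _ n ih =>
    subst hn
    by_cases hb : b = z
    · subst hb; exact ⟨0, by simp⟩
    obtain ⟨c, hc, hbc⟩ := hρ b hb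
    obtain ⟨s, hs⟩ := ih _ hc c rfl
    have hne : b ≠ c := by rintro rfl; exact lt_irrefl _ hc
    have h1 := (hasDerivAt_exp_smul_apply A 0 b c).tendsto_slope_zero_right
    simp only [zero_add, zero_smul, NormedSpace.exp_zero, Matrix.mul_one,
      Matrix.one_apply_ne hne, sub_zero, smul_eq_mul] at h1
    obtain ⟨t, ht, ht0⟩ :=
      ((h1.eventually (lt_mem_nhds hbc)).and self_mem_nhdsWithin).exists
    have ht0' : (0 : ℝ) < t := ht0
    have hpos : 0 < NormedSpace.exp (t • A) b c := by
      rwa [mul_pos_iff_of_pos_left (inv_pos.2 ht0')] at ht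
    refine ⟨t.toNNReal + s, ?_⟩
    rw [NNReal.coe_add, Real.coe_toNNReal t ht0'.le, exp_smul_add, Matrix.mul_apply]
    refine (mul_pos hpos hs).trans_le (Finset.single_le_sum (f := fun k =>
      NormedSpace.exp (t • A) b k * NormedSpace.exp ((s : ℝ) • A) k z)
      (fun k _ => ?_) (Finset.mem_univ c))
    exact mul_nonneg (exp_smul_nonneg hA ht0'.le _ _) (exp_smul_nonneg hA s.2 _ _)

/-- For a Metzler matrix with an absorbing state that is reachable from everywhere, boundedness of
the column of that state forces convergence of the exponential. -/
theorem exists_tendsto_exp_smul [Nonempty ι] {A : Matrix ι ι ℝ} (hA : ∀ i j, i ≠ j → 0 ≤ A i j)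
    {z : ι} (hz : ∀ j, A z j = 0) (ρ : ι → ℕ) (hρ : ∀ b, b ≠ z → ∃ c, ρ c < ρ b ∧ 0 < A b c)
    {a : ι} {C : ℝ} (hC : ∀ t : ℝ≥0, NormedSpace.exp ((t : ℝ) • A) a z ≤ C) :
    ∃ M : ℝ, Tendsto (fun t : ℝ≥0 => NormedSpace.exp ((t : ℝ) • A) a z) atTop (𝓝 M) ∧
      ∀ b, b ≠ z → Tendsto (fun t : ℝ≥0 => NormedSpace.exp ((t : ℝ) • A) a b) atTop (𝓝 0) := by
  have hE : ∀ (t : ℝ≥0) (i j : ι), 0 ≤ NormedSpace.exp ((t : ℝ) • A) i j :=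
    fun t => exp_smul_nonneg hA t.2
  have hzz : ∀ t : ℝ≥0, NormedSpace.exp ((t : ℝ) • A) z z = 1 := fun t => by
    rw [exp_smul_absorbing hz, Matrix.one_apply_eq]
  -- In the product for time `t + s`, only the intermediate states `z` and `b` are kept; the other
  -- terms are nonnegative.
  have key : ∀ (s t : ℝ≥0) (b : ι), b ≠ z → NormedSpace.exp ((t : ℝ) • A) a z +
      NormedSpace.exp ((t : ℝ) • A) a b * NormedSpace.exp ((s : ℝ) • A) b z
        ≤ NormedSpace.exp (((t + s : ℝ≥0) : ℝ) • A) a z := by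
    intro s t b hb
    rw [NNReal.coe_add, exp_smul_add, Matrix.mul_apply]
    have h := Finset.sum_le_sum_of_subset_of_nonneg (Finset.subset_univ {z, b})
      (f := fun k => NormedSpace.exp ((t : ℝ) • A) a k * NormedSpace.exp ((s : ℝ) • A) k z)
      fun k _ _ => mul_nonneg (hE t a k) (hE s k z)
    rwa [Finset.sum_pair hb.symm, hzz, mul_one] at h
  have hmono : Monotone fun t : ℝ≥0 => NormedSpace.exp ((t : ℝ) • A) a z := by
    intro t t' htt'
    obtain ⟨s, rfl⟩ := exists_add_of_le htt'
    change _ ≤ NormedSpace.exp (((t + s : ℝ≥0) : ℝ) • A) a z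
    rw [NNReal.coe_add, exp_smul_add, Matrix.mul_apply]
    have h := Finset.single_le_sum
      (f := fun k => NormedSpace.exp ((t : ℝ) • A) a k * NormedSpace.exp ((s : ℝ) • A) k z)
      (fun k _ => mul_nonneg (hE t a k) (hE s k z)) (Finset.mem_univ z)
    rwa [hzz, mul_one] at h
  have hbdd : BddAbove (Set.range fun t : ℝ≥0 => NormedSpace.exp ((t : ℝ) • A) a z) :=
    ⟨C, by rintro _ ⟨t, rfl⟩; exact hC t⟩
  have hM := tendsto_atTop_ciSup hmono hbdd
  refine ⟨_, hM, fun b hb => ?_⟩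
  -- With `s` fixed so that the weight from `b` to `z` is positive, `key` bounds the entry at `b` by
  -- an increment over time `s` of a convergent function.
  obtain ⟨s, hs⟩ := exists_exp_smul_pos hA ρ hρ b
  have h1 := ((hM.comp (tendsto_atTop_mono (fun t : ℝ≥0 => le_self_add (b := s))
    tendsto_id)).sub hM).div_const (NormedSpace.exp ((s : ℝ) • A) b z)
  rw [sub_self, zero_div] at h1
  refine squeeze_zero (fun t => hE t a b) (fun t => ?_) h1
  rw [le_div_iff₀ hs]
  exact le_sub_iff_add_le'.2 (key s t b hb)

/-- Uniqueness for a linear system of integral equations. -/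
theorem eq_exp_smul_mulVec {A : Matrix ι ι ℝ} {u : ℝ → ι → ℝ} (hu : Continuous u)
    (h : ∀ t, 0 ≤ t → ∀ i, u t i - u 0 i = ∫ s in (0 : ℝ)..t, ∑ j, A i j * u s j) {t : ℝ}
    (ht : 0 ≤ t) : u t = (NormedSpace.exp (t • A)).mulVec (u 0) := by
  have hc : ∀ i, Continuous fun s => ∑ j, A i j * u s j := fun i =>
    continuous_finsetSum _ fun j _ => continuous_const.mul ((continuous_apply j).comp hu)
  -- The integral equation is known at nonnegative times only, so just the right derivative is
  -- available; this suffices for ODE uniqueness.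
  have hd : ∀ s ∈ Set.Ico 0 t, HasDerivWithinAt u (A.mulVec (u s)) (Set.Ici s) s := by
    intro s hs
    rw [hasDerivWithinAt_pi]
    intro i
    have h1 : HasDerivAt (fun r => u 0 i + ∫ x in (0 : ℝ)..r, ∑ j, A i j * u x j)
        (∑ j, A i j * u s j) s :=
      (intervalIntegral.integral_hasDerivAt_right ((hc i).intervalIntegrable _ _)
        ((hc i).stronglyMeasurableAtFilter _ _) (hc i).continuousAt).const_add _
    refine h1.hasDerivWithinAt.congr (fun r hr => ?_) ?_
    · rw [← h r (hs.1.trans hr) i]; ring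
    · rw [← h s hs.1 i]; ring
  have hd' : ∀ s, HasDerivAt (fun s : ℝ => (NormedSpace.exp (s • A)).mulVec (u 0))
      (A.mulVec ((NormedSpace.exp (s • A)).mulVec (u 0))) s := by
    intro s
    rw [hasDerivAt_pi]
    intro i
    have : HasDerivAt (fun s : ℝ => ∑ j, NormedSpace.exp (s • A) i j * u 0 j)
        (∑ j, (A * NormedSpace.exp (s • A)) i j * u 0 j) s :=
      HasDerivAt.fun_sum fun j _ => (hasDerivAt_exp_smul_apply A s i j).mul_const _
    rw [Matrix.mulVec_mulVec]
    exact this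
  obtain ⟨K, hK⟩ : ∃ K, LipschitzWith K A.mulVec :=
    ⟨_, (LinearMap.toContinuousLinearMap (Matrix.mulVecLin A)).lipschitz⟩
  refine ODE_solution_unique (v := fun _ => A.mulVec) (fun _ => hK) hu.continuousOn hd
    (fun s _ => (hd' s).continuousAt.continuousWithinAt) (fun s _ => (hd' s).hasDerivWithinAt) ?_
    (Set.right_mem_Icc.2 ht)
  simp

end MetzlerMatrix

/-! ### Monomials and their partial derivatives -/

section Monomials

theorem sub_single_add_single {V : Type*} [DecidableEq V] {a : V → ℕ} {i : V} (h : a i ≠ 0) :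
    a - Pi.single i 1 + Pi.single i 1 = a := by
  funext k
  by_cases hk : k = i
  · subst hk
    simp only [Pi.add_apply, Pi.sub_apply, Pi.single_eq_same]
    omega
  · simp [hk]

/-- The prefactor `a i` makes truncated subtraction harmless: both sides vanish when `a i = 0`. -/
theorem cast_sub_single_apply_same {V : Type*} [DecidableEq V] (a : V → ℕ) (i : V) :
    (a i : ℝ) * (((a - Pi.single i 1 : V → ℕ) i : ℕ) : ℝ) = a i * (a i - 1) := by
  by_cases h : a i = 0
  · simp [h]
  · simp [Nat.cast_sub (Nat.one_le_iff_ne_zero.2 h)]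

theorem killingRate_zero {V : Type*} [Fintype V] (G : SimpleGraph V) [DecidableRel G.Adj]
    (α : ℝ) : killingRate G α 0 = 0 := by
  simp [killingRate]

variable {V : Type*} [Fintype V]

/-- The monomial `x ↦ ∏ x_i ^ a_i`. -/
def monomialFun (a : V → ℕ) (x : V → ℝ) : ℝ := ∏ i, x i ^ a i

theorem contDiff_monomialFun (a : V → ℕ) {n : WithTop ℕ∞} : ContDiff ℝ n (monomialFun a) :=
  contDiff_prod fun i _ => (contDiff_apply ℝ ℝ i).pow _

theorem monomialFun_zero (x : V → ℝ) : monomialFun 0 x = 1 := by simp [monomialFun]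

theorem monomialFun_add (a b : V → ℕ) (x : V → ℝ) :
    monomialFun (a + b) x = monomialFun a x * monomialFun b x := by
  simp [monomialFun, pow_add, Finset.prod_mul_distrib]

variable [DecidableEq V]

theorem monomialFun_single (i : V) (x : V → ℝ) : monomialFun (Pi.single i 1) x = x i := by
  rw [monomialFun, Finset.prod_eq_single i]
  · simp
  · intro j _ hj; simp [hj]
  · simp

theorem cast_mul_monomialFun_sub_single (a : V → ℕ) (i : V) (x : V → ℝ) :
    (a i : ℝ) * (x i * monomialFun (a - Pi.single i 1) x) = a i * monomialFun a x := by
  by_cases h : a i = 0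
  · simp [h]
  · conv_rhs => rw [← sub_single_add_single h, monomialFun_add, monomialFun_single]
    rw [sub_single_add_single h]
    ring

theorem partialDeriv_monomialFun (a : V → ℕ) (i : V) :
    partialDeriv i (monomialFun a) = fun x => a i * monomialFun (a - Pi.single i 1) x := by
  funext x
  have hsplit : ∀ (b : V → ℕ) (y : V → ℝ), monomialFun b y =
      y i ^ b i * ∏ k ∈ Finset.univ.erase i, y k ^ b k := fun b y =>
    (Finset.mul_prod_erase _ (fun k => y k ^ b k) (Finset.mem_univ i)).symm
  have h1 : HasLineDerivAt ℝ (monomialFun a) (a i * monomialFun (a - Pi.single i 1) x) x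
      (Pi.single i 1) := by
    have h2 : (fun t : ℝ => monomialFun a (x + t • Pi.single i 1)) =
        fun t => (x i + t) ^ a i * ∏ k ∈ Finset.univ.erase i, x k ^ a k := by
      funext t
      rw [hsplit]
      congr 1
      · simp
      · refine Finset.prod_congr rfl fun k hk => ?_
        simp [Finset.ne_of_mem_erase hk]
    rw [HasLineDerivAt, h2, hsplit]
    have h3 := (((hasDerivAt_id (0 : ℝ)).const_add (x i)).pow (a i)).mul_const
      (∏ k ∈ Finset.univ.erase i, x k ^ a k)
    refine h3.congr_deriv ?_
    have h4 : ∏ k ∈ Finset.univ.erase i, x k ^ (a - Pi.single i 1 : V → ℕ) k =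
        ∏ k ∈ Finset.univ.erase i, x k ^ a k :=
      Finset.prod_congr rfl fun k hk => by simp [Finset.ne_of_mem_erase hk]
    rw [h4]
    simp [mul_assoc]
  rw [partialDeriv, ← ((contDiff_monomialFun a (n := 1)).differentiable
    (by norm_num) x).lineDeriv_eq_fderiv]
  exact h1.lineDeriv

theorem partialDeriv_partialDeriv_monomialFun (a : V → ℕ) (i j : V) (x : V → ℝ) :
    partialDeriv i (partialDeriv j (monomialFun a)) x =
      a j * (((a - Pi.single j 1 : V → ℕ) i : ℝ) * monomialFun (a - Pi.single j 1 - Pi.single i 1) x) := by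
  have h := congr_fun (partialDeriv_monomialFun (a - Pi.single j 1) i) x
  rw [partialDeriv_monomialFun, partialDeriv, fderiv_const_mul
    ((contDiff_monomialFun _ (n := 1)).differentiable (by norm_num) x)]
  rw [partialDeriv] at h
  rw [smul_apply, h, smul_eq_mul]

end Monomials

/-! ### The dual rates and the duality relation for generators -/

section Rates

variable {V : Type*} [Fintype V] [DecidableEq V] (G : SimpleGraph V) [DecidableRel G.Adj]

theorem sum_add_single (a : V → ℕ) (i : V) : ∑ k, (a + Pi.single i 1 : V → ℕ) k = ∑ k, a k + 1 := by
  simp [Finset.sum_add_distrib]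

/-- The condition has the unique solution `b = a - e_i + c` when `a i ≠ 0`; when `a i = 0` the
subtraction truncates, but the weight is zero. -/
theorem sum_ite_shift {s : Finset (V → ℕ)} {a c : V → ℕ} {i : V} {w : ℝ}
    (h0 : a i = 0 → w = 0) (hs : a i ≠ 0 → a - Pi.single i 1 + c ∈ s) (φ : (V → ℕ) → ℝ) :
    ∑ b ∈ s, (if b + Pi.single i 1 = a + c then w else 0) * φ b =
      w * φ (a - Pi.single i 1 + c) := by
  by_cases h : a i = 0
  · simp [h0 h]
  rw [Finset.sum_eq_single_of_mem _ (hs h)]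
  · rw [if_pos]
    rw [add_right_comm, sub_single_add_single h]
  · intro b _ hb
    rw [if_neg, zero_mul]
    intro hb'
    apply hb
    rw [← add_left_inj (Pi.single i 1), hb', add_right_comm, sub_single_add_single h]

theorem jumpRate_nonneg {α : ℝ} (hα : 0 ≤ α) (a b : V → ℕ) : 0 ≤ jumpRate G α a b := by
  refine add_nonneg (Finset.sum_nonneg fun i _ => Finset.sum_nonneg fun j _ => ?_)
    (Finset.sum_nonneg fun i _ => ?_)
  · split_ifs
    · rcases Nat.eq_zero_or_pos (a i) with h | h
      · simp [h]
      · have : (1 : ℝ) ≤ a i := by exact_mod_cast h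
        have : 0 ≤ (a i : ℝ) - 1 := by linarith
        positivity
    · exact le_rfl
  · split_ifs <;> positivity

theorem jumpRate_self (α : ℝ) (a : V → ℕ) : jumpRate G α a a = 0 := by
  rw [jumpRate, Finset.sum_eq_zero, Finset.sum_eq_zero, add_zero]
  · intro i _
    rw [if_neg]
    intro h
    have := congr_fun h i
    simp at this
  · intro i _
    refine Finset.sum_eq_zero fun j hj => ?_
    rw [if_neg]
    intro h
    have hij : i ≠ j := (G.ne_of_adj ((G.mem_neighborFinset i j).1 hj))
    have := congr_fun h i
    simp [hij] at this

theorem jumpRate_eq_zero {α : ℝ} {a b : V → ℕ} (h : ∑ i, a i < ∑ i, b i) :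
    jumpRate G α a b = 0 := by
  rw [jumpRate, Finset.sum_eq_zero, Finset.sum_eq_zero, add_zero]
  · intro i _
    rw [if_neg]
    intro h'
    have := sum_add_single b i
    rw [h'] at this
    omega
  · intro i _
    refine Finset.sum_eq_zero fun j hj => ?_
    rw [if_neg]
    intro h'
    have := sum_add_single b i
    rw [h', sum_add_single] at this
    omega

theorem sum_jumpRate_mul (α : ℝ) {s : Finset (V → ℕ)} {a : V → ℕ}
    (hs : ∀ b : V → ℕ, ∑ i, b i ≤ ∑ i, a i → b ∈ s) (φ : (V → ℕ) → ℝ) :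
    ∑ b ∈ s, jumpRate G α a b * φ b =
      (∑ i, ∑ j ∈ G.neighborFinset i,
        (a i : ℝ) * ((a i : ℝ) - 1) / 2 * φ (a - Pi.single i 1 + Pi.single j 1))
      + ∑ i, α / 2 * (a i : ℝ) * φ (a - Pi.single i 1) := by
  have hsum : ∀ i, a i ≠ 0 → ∑ k, (a - Pi.single i 1 : V → ℕ) k + 1 = ∑ k, a k := fun i hi => by
    rw [← sum_add_single, sub_single_add_single hi]
  simp only [jumpRate, add_mul, Finset.sum_mul, Finset.sum_add_distrib]
  congr 1
  · rw [Finset.sum_comm]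
    refine Finset.sum_congr rfl fun i _ => ?_
    rw [Finset.sum_comm]
    refine Finset.sum_congr rfl fun j _ => ?_
    refine sum_ite_shift (fun h => by simp [h]) (fun h => hs _ ?_) φ
    rw [sum_add_single, hsum i h]
  · rw [Finset.sum_comm]
    refine Finset.sum_congr rfl fun i _ => ?_
    have := sum_ite_shift (s := s) (a := a) (c := 0) (i := i) (w := α / 2 * (a i : ℝ))
      (fun h => by simp [h]) (fun h => hs _ ?_) φ
    · simpa using this
    · rw [add_zero, ← hsum i h]
      exact Nat.le_succ _

/-- Jumps never raise the degree, so the `finsum` of exit rates is supported in `s`. -/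
theorem rateMatrix_eq (α : ℝ) {s : Finset (V → ℕ)} {a : V → ℕ}
    (hs : ∀ b : V → ℕ, ∑ i, b i ≤ ∑ i, a i → b ∈ s) (b : V → ℕ) :
    rateMatrix G α a b = jumpRate G α a b - if a = b then ∑ c ∈ s, jumpRate G α a c else 0 := by
  rw [rateMatrix]
  split_ifs with h
  · subst h
    rw [jumpRate_self, zero_sub]
    congr 1
    have h1 : ∀ c, (∑ᶠ _ : c ≠ a, jumpRate G α a c) = jumpRate G α a c := by
      intro c
      by_cases hc : c = a
      · subst hc; simp [jumpRate_self]
      · simp [hc]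
    simp only [h1]
    refine finsum_eq_sum_of_support_subset _ fun c hc => hs c ?_
    by_contra hlt
    exact hc (jumpRate_eq_zero G (not_le.1 hlt))
  · rw [sub_zero]

theorem sum_rateMatrix_mul (α : ℝ) {s : Finset (V → ℕ)} {a : V → ℕ}
    (hs : ∀ b : V → ℕ, ∑ i, b i ≤ ∑ i, a i → b ∈ s) (φ : (V → ℕ) → ℝ) :
    ∑ b ∈ s, rateMatrix G α a b * φ b = ∑ b ∈ s, jumpRate G α a b * (φ b - φ a) := by
  simp only [rateMatrix_eq G α hs, sub_mul, mul_sub, Finset.sum_sub_distrib, ite_mul, zero_mul,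
    Finset.sum_ite_eq, if_pos (hs a le_rfl), Finset.sum_mul]

theorem rateMatrix_nonneg {α : ℝ} (hα : 0 ≤ α) {a b : V → ℕ} (h : a ≠ b) :
    0 ≤ rateMatrix G α a b := by
  rw [rateMatrix, if_neg h]
  exact jumpRate_nonneg G hα a b

theorem jumpRate_zero_left (α : ℝ) (b : V → ℕ) : jumpRate G α 0 b = 0 := by
  simp [jumpRate]

theorem rateMatrix_zero_left (α : ℝ) (b : V → ℕ) : rateMatrix G α 0 b = 0 := by
  simp [rateMatrix, jumpRate_zero_left]

theorem exists_rateMatrix_pos {α : ℝ} (hα : 0 < α) {b : V → ℕ} (hb : b ≠ 0) :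
    ∃ c : V → ℕ, ∑ i, c i < ∑ i, b i ∧ 0 < rateMatrix G α b c := by
  obtain ⟨i, hi⟩ := Function.ne_iff.1 hb
  have hi : b i ≠ 0 := hi
  have h1 := sub_single_add_single hi
  have h2 := sum_add_single (b - Pi.single i 1) i
  rw [h1] at h2
  refine ⟨b - Pi.single i 1, by omega, ?_⟩
  rw [rateMatrix, if_neg]
  · have hi' : (0 : ℝ) < b i := by exact_mod_cast Nat.pos_of_ne_zero hi
    refine add_pos_of_nonneg_of_pos (Finset.sum_nonneg fun k _ => Finset.sum_nonneg fun j _ => ?_) ?_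
    · split_ifs
      · rcases Nat.eq_zero_or_pos (b k) with h | h
        · simp [h]
        · have : (1 : ℝ) ≤ b k := by exact_mod_cast h
          have : 0 ≤ (b k : ℝ) - 1 := by linarith
          positivity
      · exact le_rfl
    · refine Finset.sum_pos' (fun k _ => by split_ifs <;> positivity) ⟨i, Finset.mem_univ i, ?_⟩
      rw [if_pos h1]
      positivity
  · intro h
    rw [← h] at h2
    omega

/-- The matrix `R - diag k` of the dual chain with killing. -/
def killedRate (α : ℝ) (a b : V → ℕ) : ℝ :=
  rateMatrix G α a b - if a = b then killingRate G α a else 0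

theorem killedRate_nonneg {α : ℝ} (hα : 0 ≤ α) {a b : V → ℕ} (h : a ≠ b) :
    0 ≤ killedRate G α a b := by
  rw [killedRate, if_neg h, sub_zero]
  exact rateMatrix_nonneg G hα h

theorem killedRate_zero_left (α : ℝ) (b : V → ℕ) : killedRate G α 0 b = 0 := by
  simp [killedRate, rateMatrix_zero_left, killingRate_zero]

/-- The duality relation between the generator of the diffusion and the dual chain. -/
theorem generatorFun_monomialFun (α : ℝ) {s : Finset (V → ℕ)} {a : V → ℕ}
    (hs : ∀ b : V → ℕ, ∑ i, b i ≤ ∑ i, a i → b ∈ s) (x : V → ℝ) :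
    generatorFun G α (monomialFun a) x = ∑ b ∈ s, killedRate G α a b * monomialFun b x := by
  -- On the diagonal, `x_i x_k` restores one of the two lowered powers of `x_i` and adds a power of
  -- `x_k`: a jump `a → a - e_i + e_k`. Off the diagonal both lowered powers return, leaving a
  -- multiple of `x^a`, which goes into the killing.
  have hterm : ∀ i j, sigma G i j x * partialDeriv i (partialDeriv j (monomialFun a)) x =
      (if i = j then ∑ k ∈ G.neighborFinset i, (a i : ℝ) * ((a i : ℝ) - 1) *
        monomialFun (a - Pi.single i 1 + Pi.single k 1) x else 0)
      - (if G.Adj i j then (a i : ℝ) * (a j : ℝ) * monomialFun a x else 0) := by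
    intro i j
    rw [partialDeriv_partialDeriv_monomialFun, sigma]
    by_cases hij : i = j
    · subst hij
      rw [if_pos rfl, if_pos rfl, if_neg (G.irrefl), sub_zero, Finset.mul_sum, Finset.sum_mul]
      refine Finset.sum_congr rfl fun k _ => ?_
      have h1 := cast_mul_monomialFun_sub_single (a - Pi.single i 1) i x
      rw [monomialFun_add, monomialFun_single, ← cast_sub_single_apply_same]
      linear_combination (x k * a i) * h1
    · rw [if_neg hij, if_neg hij, zero_sub]
      split_ifs with h
      · have h1 := cast_mul_monomialFun_sub_single (a - Pi.single j 1) i x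
        have h2 := cast_mul_monomialFun_sub_single a j x
        have h3 : (a - Pi.single j 1 : V → ℕ) i = a i := by simp [hij]
        rw [h3] at h1 ⊢
        linear_combination (-(x j * a j)) * h1 - (a i : ℝ) * h2
      · simp
  have hadj : ∀ i, (∑ j, if G.Adj i j then (a i : ℝ) * (a j : ℝ) * monomialFun a x else 0) =
      ∑ j ∈ G.neighborFinset i, (a i : ℝ) * (a j : ℝ) * monomialFun a x := by
    intro i
    rw [SimpleGraph.neighborFinset_eq_filter, Finset.sum_filter]
  have hdrift : ∀ i, drift α i x * partialDeriv i (monomialFun a) x =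
      α / 2 * (a i : ℝ) * monomialFun (a - Pi.single i 1) x -
        α / 2 * (Fintype.card V : ℝ) * (a i : ℝ) * monomialFun a x := by
    intro i
    rw [partialDeriv_monomialFun, drift]
    linear_combination (-(α / 2 * (Fintype.card V : ℝ))) * cast_mul_monomialFun_sub_single a i x
  rw [generatorFun]
  simp only [hterm, hdrift, Finset.sum_sub_distrib, hadj, Finset.sum_ite_eq, Finset.mem_univ,
    if_true]
  simp only [killedRate, sub_mul, Finset.sum_sub_distrib, ite_mul, zero_mul, Finset.sum_ite_eq,
    if_pos (hs a le_rfl)]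
  rw [sum_rateMatrix_mul G α hs, sum_jumpRate_mul G α hs fun b => monomialFun b x - monomialFun a x,
    killingRate]
  -- The rows of `R` sum to zero, so each jump term is a difference. The subtracted `x^a` produces
  -- the negative degree term of the killing rate here, and in `e2` turns the drift coefficient `r`
  -- into `r - 1`.
  have e1 : (∑ i, ∑ j ∈ G.neighborFinset i, (a i : ℝ) * ((a i : ℝ) - 1) / 2 *
      (monomialFun (a - Pi.single i 1 + Pi.single j 1) x - monomialFun a x)) =
      1 / 2 * (∑ i, ∑ j ∈ G.neighborFinset i, (a i : ℝ) * ((a i : ℝ) - 1) *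
        monomialFun (a - Pi.single i 1 + Pi.single j 1) x) -
      (∑ i, (G.degree i : ℝ) * (a i : ℝ) * ((a i : ℝ) - 1) / 2) * monomialFun a x := by
    rw [Finset.mul_sum, Finset.sum_mul, ← Finset.sum_sub_distrib]
    refine Finset.sum_congr rfl fun i _ => ?_
    simp only [mul_sub, Finset.sum_sub_distrib, Finset.sum_const,
      SimpleGraph.card_neighborFinset_eq_degree, nsmul_eq_mul]
    rw [Finset.mul_sum]
    congr 1
    · exact Finset.sum_congr rfl fun j _ => by ring
    · ring
  have e2 : (∑ i, α / 2 * (a i : ℝ) * (monomialFun (a - Pi.single i 1) x - monomialFun a x)) =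
      (∑ i, α / 2 * (a i : ℝ) * monomialFun (a - Pi.single i 1) x) -
        α / 2 * (∑ i, (a i : ℝ)) * monomialFun a x := by
    rw [Finset.mul_sum, Finset.sum_mul, ← Finset.sum_sub_distrib]
    exact Finset.sum_congr rfl fun i _ => by ring
  have e3 : (∑ i, ∑ j ∈ G.neighborFinset i, (a i : ℝ) * (a j : ℝ) * monomialFun a x) =
      2 * (∑ i, ∑ j ∈ G.neighborFinset i, (a i : ℝ) * (a j : ℝ) / 2) * monomialFun a x := by
    simp only [Finset.mul_sum, Finset.sum_mul]
    exact Finset.sum_congr rfl fun i _ => Finset.sum_congr rfl fun j _ => by ring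
  have e4 : (∑ i, α / 2 * (Fintype.card V : ℝ) * (a i : ℝ) * monomialFun a x) =
      α / 2 * (Fintype.card V : ℝ) * (∑ i, (a i : ℝ)) * monomialFun a x := by
    simp only [Finset.mul_sum, Finset.sum_mul]
  rw [e1, e2, e3, e4]
  ring

end Rates

/-! ### Transition functions and closed finite sets -/

section TransitionFunction

variable {S : Type*} [DecidableEq S] {R : S → S → ℝ} {p : ℝ≥0 → S → S → ℝ}

theorem IsTransitionFunction.sum_le_one (hp : IsTransitionFunction R p) (s : Finset S) (t : ℝ≥0)
    (a : S) : ∑ b ∈ s, p t a b ≤ 1 :=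
  sum_le_hasSum s (fun b _ => hp.nonneg t a b) (hp.hasSum_one t a)

/-- The probability of having left a finite set is subadditive in time. -/
theorem IsTransitionFunction.one_sub_sum_nsmul_le (hp : IsTransitionFunction R p) {s : Finset S}
    {h : ℝ≥0} {ε : ℝ} (hε : 0 ≤ ε) (hs : ∀ a ∈ s, 1 - ∑ b ∈ s, p h a b ≤ ε) (n : ℕ) :
    ∀ a ∈ s, 1 - ∑ b ∈ s, p (n • h) a b ≤ n * ε := by
  induction n with
  | zero =>
    intro a ha
    simp [hp.zero, ha]
  | succ n ih =>
    intro a ha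
    -- Chapman–Kolmogorov at the first step, discarding intermediate states outside `s`.
    have h1 : ∑ c ∈ s, p h a c * ∑ b ∈ s, p (n • h) c b ≤ ∑ b ∈ s, p ((n + 1) • h) a b := by
      simp only [Finset.mul_sum]
      rw [Finset.sum_comm]
      refine Finset.sum_le_sum fun b _ => ?_
      rw [succ_nsmul']
      exact sum_le_hasSum s (fun c _ => mul_nonneg (hp.nonneg _ _ _) (hp.nonneg _ _ _))
        (hp.chapman_kolmogorov h (n • h) a b)
    have h2 : ∑ c ∈ s, p h a c * (1 - ∑ b ∈ s, p (n • h) c b) ≤ n * ε := by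
      calc ∑ c ∈ s, p h a c * (1 - ∑ b ∈ s, p (n • h) c b) ≤ ∑ c ∈ s, p h a c * (n * ε) :=
            Finset.sum_le_sum fun c hc => mul_le_mul_of_nonneg_left (ih c hc) (hp.nonneg _ _ _)
        _ ≤ 1 * (n * ε) := by
            rw [← Finset.sum_mul]
            exact mul_le_mul_of_nonneg_right (hp.sum_le_one s h a) (by positivity)
        _ = n * ε := one_mul _
    have h3 := hs a ha
    simp only [mul_sub, mul_one, Finset.sum_sub_distrib] at h2
    push_cast
    linarith

/-- A finite set on which the rows of the rate matrix sum to zero cannot be left. -/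
theorem IsTransitionFunction.eq_zero_of_notMem (hp : IsTransitionFunction R p) {s : Finset S}
    (hs : ∀ a ∈ s, ∑ b ∈ s, R a b = 0) (t : ℝ≥0) {a b : S} (ha : a ∈ s) (hb : b ∉ s) :
    p t a b = 0 := by
  rcases eq_or_ne t 0 with rfl | ht
  · rw [hp.zero, if_neg (by rintro rfl; exact hb ha)]
  have ht0 : 0 < t := pos_iff_ne_zero.2 ht
  have hlim : ∀ a ∈ s, Tendsto (fun h : ℝ≥0 => (1 - ∑ b ∈ s, p h a b) / (h : ℝ)) (𝓝[>] 0)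
      (𝓝 0) := by
    intro a ha
    have h1 := (tendsto_finsetSum s fun b _ => hp.rate a b).neg
    rw [hs a ha, neg_zero] at h1
    refine h1.congr fun h => ?_
    rw [← Finset.sum_div, Finset.sum_sub_distrib, Finset.sum_ite_eq, if_pos ha, ← neg_div, neg_sub]
  -- Zero row sums make the exit probability `o(h)`, uniformly over the finite set; `n` steps of
  -- length `t / n` then cost at most `n · ε t / n`.
  have hbound : ∀ ε : ℝ, 0 < ε → 1 - ∑ b ∈ s, p t a b ≤ ε * t := by
    intro ε hε
    have h1 : ∀ᶠ h in 𝓝[>] (0 : ℝ≥0), ∀ a ∈ s, 1 - ∑ b ∈ s, p h a b ≤ ε * h := by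
      rw [eventually_all_finset]
      intro a ha
      filter_upwards [(hlim a ha).eventually (gt_mem_nhds hε), self_mem_nhdsWithin] with h h1 h0
      have h0' : (0 : ℝ) < h := NNReal.coe_pos.2 h0
      exact ((div_lt_iff₀ h0').1 h1).le
    have h2 : Tendsto (fun n : ℕ => t / (n : ℝ≥0)) atTop (𝓝[>] 0) := by
      refine tendsto_nhdsWithin_iff.2 ⟨?_, ?_⟩
      · rw [← NNReal.tendsto_coe]
        simpa using tendsto_const_div_atTop_nhds_zero_nat (t : ℝ)
      · filter_upwards [eventually_gt_atTop 0] with n hn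
        exact div_pos ht0 (Nat.cast_pos.2 hn)
    obtain ⟨n, hn, hn0⟩ := ((h2.eventually h1).and (eventually_gt_atTop 0)).exists
    have h3 := hp.one_sub_sum_nsmul_le (by positivity) hn n a ha
    have hn1 : (n : ℝ) ≠ 0 := Nat.cast_ne_zero.2 hn0.ne'
    have h4 : n • (t / (n : ℝ≥0)) = t := by
      rw [nsmul_eq_mul, mul_div_cancel₀ _ (Nat.cast_ne_zero.2 hn0.ne')]
    rw [h4] at h3
    refine h3.trans (le_of_eq ?_)
    push_cast
    field_simp
  have hle : 1 - ∑ b ∈ s, p t a b ≤ 0 := by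
    refine le_of_forall_pos_le_add fun ε hε => ?_
    have ht' : (0 : ℝ) < t := NNReal.coe_pos.2 ht0
    have := hbound (ε / t) (div_pos hε ht')
    rwa [div_mul_cancel₀ _ ht'.ne', ← zero_add ε] at this
  have h5 := hp.sum_le_one (insert b s) t a
  rw [Finset.sum_insert hb] at h5
  have := hp.nonneg t a b
  linarith

theorem IsTransitionFunction.tendsto_rate (hp : IsTransitionFunction R p) (a b : S) :
    Tendsto (fun h : ℝ => h⁻¹ * (p h.toNNReal a b - if a = b then 1 else 0)) (𝓝[>] 0)
      (𝓝 (R a b)) := by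
  have h1 : Tendsto Real.toNNReal (𝓝[>] 0) (𝓝[>] 0) := by
    refine tendsto_nhdsWithin_iff.2 ⟨?_, ?_⟩
    · have := (continuous_real_toNNReal.tendsto 0).mono_left (nhdsWithin_le_nhds (s := Set.Ioi 0))
      rwa [Real.toNNReal_zero] at this
    · filter_upwards [self_mem_nhdsWithin] with h h0
      exact Real.toNNReal_pos.2 h0
  refine ((hp.rate a b).comp h1).congr' ?_
  filter_upwards [self_mem_nhdsWithin] with h h0
  rw [Function.comp_apply, Real.coe_toNNReal h (le_of_lt h0), div_eq_inv_mul]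

end TransitionFunction

/-! ### Riemann sums of right-continuous functions -/

section RiemannSum

/-- Riemann sums with right endpoints of a bounded right-continuous function. -/
theorem tendsto_riemannSum_right {f : ℝ → ℝ} {C t : ℝ} (ht : 0 < t) (hC : ∀ s, |f s| ≤ C)
    (hf : ∀ s, 0 ≤ s → ContinuousWithinAt f (Set.Ici s) s) :
    Tendsto (fun n : ℕ => t / n * ∑ i ∈ Finset.range n, f ((i + 1 : ℕ) * (t / n))) atTop
      (𝓝 (∫ s in (0 : ℝ)..t, f s)) := by
  -- The `+ 1` selects the right end of the cell containing `s`, so the sampling points approach `s`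
  -- from the right, where `f` is continuous.
  let F : ℕ → ℝ → ℝ := fun n s => f ((⌊s / (t / n)⌋₊ + 1 : ℕ) * (t / n))
  have hF : ∀ n, Measurable (F n) := fun n =>
    (measurable_from_nat (f := fun m : ℕ => f ((m + 1 : ℕ) * (t / n)))).comp
      (Nat.measurable_floor.comp (measurable_id.div_const _))
  have hsum : ∀ᶠ n : ℕ in atTop, ∫ s in (0 : ℝ)..t, F n s =
      t / n * ∑ i ∈ Finset.range n, f ((i + 1 : ℕ) * (t / n)) := by
    filter_upwards [eventually_gt_atTop 0] with n hn
    have hn' : (0 : ℝ) < n := Nat.cast_pos.2 hn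
    have hδ : 0 < t / n := div_pos ht hn'
    have h1 : ∀ i : ℕ, ∫ s in (i : ℝ) * (t / n)..(i + 1 : ℕ) * (t / n), F n s =
        t / n * f ((i + 1 : ℕ) * (t / n)) := by
      intro i
      have h2 : ∫ s in (i : ℝ) * (t / n)..(i + 1 : ℕ) * (t / n), F n s =
          ∫ s in (i : ℝ) * (t / n)..(i + 1 : ℕ) * (t / n), f ((i + 1 : ℕ) * (t / n)) := by
        refine intervalIntegral.integral_congr_Ioo_of_le ?_ fun s hs => ?_
        · exact mul_le_mul_of_nonneg_right (by exact_mod_cast i.le_succ) hδ.le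
        · have h3 : ⌊s / (t / n)⌋₊ = i := by
            rw [Nat.floor_eq_iff (div_nonneg ((by positivity : (0:ℝ) ≤ i * (t / n)).trans hs.1.le)
              hδ.le), le_div_iff₀ hδ, div_lt_iff₀ hδ]
            exact ⟨hs.1.le, by exact_mod_cast hs.2⟩
          simp only [F, h3]
      rw [h2, intervalIntegral.integral_const, smul_eq_mul]
      push_cast
      ring
    have h4 := intervalIntegral.sum_integral_adjacent_intervals (f := F n) (μ := volume)
      (a := fun i : ℕ => (i : ℝ) * (t / n)) (n := n) (fun i _ => by
        refine (intervalIntegrable_const (c := C)).mono_fun (hF n).aestronglyMeasurable ?_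
        refine Eventually.of_forall fun s => ?_
        simp only [Real.norm_eq_abs]
        exact (hC _).trans (le_abs_self C))
    rw [Finset.mul_sum, ← Finset.sum_congr rfl fun i _ => h1 i]
    rw [Nat.cast_zero, zero_mul, mul_div_cancel₀ _ hn'.ne'] at h4
    exact h4.symm
  refine Tendsto.congr' hsum ?_
  refine intervalIntegral.tendsto_integral_filter_of_dominated_convergence (fun _ => C)
    (Eventually.of_forall fun n => (hF n).aestronglyMeasurable)
    (Eventually.of_forall fun n => Eventually.of_forall fun s _ => hC _)
    intervalIntegrable_const (Eventually.of_forall fun s hs => ?_)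
  rw [Set.uIoc_of_le ht.le] at hs
  refine (hf s hs.1.le).tendsto.comp (tendsto_nhdsWithin_iff.2 ⟨?_, ?_⟩)
  · have hδ := tendsto_const_div_atTop_nhds_zero_nat t
    have h5 : Tendsto (fun n : ℕ => s + t / (n : ℝ)) atTop (𝓝 s) := by
      simpa using hδ.const_add s
    refine tendsto_of_tendsto_of_tendsto_of_le_of_le' tendsto_const_nhds h5 ?_ ?_
    · filter_upwards [eventually_gt_atTop 0] with n hn
      have hδ : 0 < t / (n : ℝ) := div_pos ht (Nat.cast_pos.2 hn)
      rw [← div_le_iff₀ hδ]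
      exact_mod_cast (Nat.lt_floor_add_one _).le
    · filter_upwards [eventually_gt_atTop 0] with n hn
      have hδ : 0 < t / (n : ℝ) := div_pos ht (Nat.cast_pos.2 hn)
      have h6 := Nat.floor_le (div_nonneg hs.1.le hδ.le)
      rw [le_div_iff₀ hδ] at h6
      push_cast
      linarith
  · filter_upwards [eventually_gt_atTop 0] with n hn
    have hδ : 0 < t / (n : ℝ) := div_pos ht (Nat.cast_pos.2 hn)
    rw [Set.mem_Ici, ← div_le_iff₀ hδ]
    exact_mod_cast (Nat.lt_floor_add_one _).le

end RiemannSum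

/-! ### Path properties and the chain sampled on a grid -/

section Grid

theorem measureReal_eq_transition {S : Type*} {a : S} {Ω : Type*} [MeasurableSpace Ω]
    {P : Measure Ω} {X : ℝ≥0 → Ω → S} {p : ℝ≥0 → S → S → ℝ} (h0 : ∀ᵐ ω ∂P, X 0 ω = a)
    (hfd : ∀ (n : ℕ) (t : ℕ → ℝ≥0) (b : ℕ → S), t 0 = 0 → Monotone t → b 0 = a →
      P.real {ω | ∀ k ≤ n, X (t k) ω = b k}
        = ∏ k ∈ Finset.range n, p (t (k + 1) - t k) (b k) (b (k + 1))) (t : ℝ≥0) (b : S) :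
    P.real {ω | X t ω = b} = p t a b := by
  have h := hfd 1 (fun k => k * t) (fun k => if k = 0 then a else b) (by simp)
    (fun i j hij => by dsimp only; gcongr) rfl
  simp only [Finset.prod_range_one, zero_add, Nat.cast_one, one_mul, Nat.cast_zero, zero_mul,
    tsub_zero, if_true, one_ne_zero, if_false] at h
  rw [← h]
  refine measureReal_congr ?_
  filter_upwards [h0] with ω hω
  refine propext ⟨fun (H : X t ω = b) k hk => ?_, fun H => ?_⟩
  · interval_cases k
    · simpa using hω
    · simpa using H
  · change X t ω = b
    simpa using H 1 le_rfl

variable {S : Type*} [DecidableEq S] {R : S → S → ℝ} {a : S}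
  {Ω : Type*} [MeasurableSpace Ω] {P : Measure Ω} {X : ℝ≥0 → Ω → S}

theorem IsMarkovChain.measurable_comp [Countable S] (hX : IsMarkovChain R a P X) (t : ℝ≥0)
    {E : Type*} [MeasurableSpace E] (g : S → E) : Measurable fun ω => g (X t ω) := by
  let _ : MeasurableSpace S := ⊤
  have h1 : Measurable (X t) := measurable_to_countable' fun b => hX.measurable t b
  exact (measurable_from_top (f := g)).comp h1

theorem IsMarkovChain.exists_transition [IsProbabilityMeasure P] (hX : IsMarkovChain R a P X) :
    ∃ p : ℝ≥0 → S → S → ℝ, IsTransitionFunction R p ∧ (∀ᵐ ω ∂P, X 0 ω = a) ∧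
    ∀ (n : ℕ) (t : ℕ → ℝ≥0) (b : ℕ → S), t 0 = 0 → Monotone t → b 0 = a →
      P.real {ω | ∀ k ≤ n, X (t k) ω = b k}
        = ∏ k ∈ Finset.range n, p (t (k + 1) - t k) (b k) (b (k + 1)) := by
  obtain ⟨p, hp, hfd⟩ := hX.markov
  refine ⟨p, hp, ?_, fun n t b h0 ht hb => ?_⟩
  · have h := hfd 0 (fun _ => 0) (fun _ => a) rfl monotone_const
    simp only [Nat.le_zero, forall_eq, if_true, Finset.range_zero, Finset.prod_empty, mul_one,
      ENNReal.ofReal_one] at h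
    rwa [← mem_ae_iff_prob_eq_one (hX.measurable 0 a)] at h
  · rw [measureReal_def, hfd n t b h0 ht, if_pos hb, one_mul,
      ENNReal.toReal_ofReal (Finset.prod_nonneg fun k _ => hp.nonneg _ _ _)]

/-- Carries almost sure path properties from a countable dense set of times to all times by
right-continuity. -/
theorem exists_dense_mem {D : Set ℝ≥0} (hD : Dense D) {t u : ℝ≥0} (htu : t < u) {Q : ℝ≥0 → Prop}
    (hQ : ∀ᶠ s in 𝓝[≥] t, Q s) : ∃ d ∈ D, t < d ∧ d < u ∧ Q d := by
  obtain ⟨v, hv, hvQ⟩ := (mem_nhdsGE_iff_exists_Ico_subset' htu).1 hQ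
  obtain ⟨d, hd, h1, h2⟩ := hD.exists_between (lt_min hv htu)
  exact ⟨d, hd, h1, h2.trans_le (min_le_right _ _), hvQ ⟨h1.le, h2.trans_le (min_le_left _ _)⟩⟩

/-- The paths stay in a finite set on which the rows of the rate matrix sum to zero. -/
theorem IsMarkovChain.ae_forall_mem [Countable S] [IsProbabilityMeasure P]
    (hX : IsMarkovChain R a P X) {s : Finset S} (ha : a ∈ s) (hs : ∀ a ∈ s, ∑ b ∈ s, R a b = 0) :
    ∀ᵐ ω ∂P, ∀ t, X t ω ∈ s := by
  obtain ⟨p, hp, h0, hfd⟩ := hX.exists_transition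
  obtain ⟨D, hDc, hD⟩ := TopologicalSpace.exists_countable_dense ℝ≥0
  have h1 : ∀ᵐ ω ∂P, ∀ t ∈ D, ∀ b, b ∉ s → X t ω ≠ b := by
    rw [ae_ball_iff hDc]
    intro t _
    rw [ae_all_iff]
    intro b
    by_cases hb : b ∈ s
    · simp [hb]
    have h2 := measureReal_eq_transition h0 hfd t b
    rw [hp.eq_zero_of_notMem hs t ha hb, measureReal_eq_zero_iff] at h2
    filter_upwards [measure_eq_zero_iff_ae_notMem.1 h2] with ω hω _ h3
    exact hω h3
  filter_upwards [h1] with ω hω t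
  obtain ⟨d, hdD, -, -, hd⟩ :=
    exists_dense_mem hD (lt_add_one t) (hX.right_continuous ω t)
  by_contra hb
  exact hω d hdD _ hb hd

/-- A state with vanishing exit rate is never left. -/
theorem IsMarkovChain.ae_absorbed [Countable S] [IsProbabilityMeasure P]
    (hX : IsMarkovChain R a P X) {z : S} (hz : R z z = 0) :
    ∀ᵐ ω ∂P, ∀ t u, t ≤ u → X t ω = z → X u ω = z := by
  obtain ⟨p, hp, h0, hfd⟩ := hX.exists_transition
  obtain ⟨D, hDc, hD⟩ := TopologicalSpace.exists_countable_dense ℝ≥0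
  have h1 : ∀ᵐ ω ∂P, ∀ q ∈ D, ∀ q' ∈ D, ∀ b, q ≤ q' → b ≠ z → X q ω = z → X q' ω ≠ b := by
    rw [ae_ball_iff hDc]
    intro q _
    rw [ae_ball_iff hDc]
    intro q' _
    rw [ae_all_iff]
    intro b
    by_cases hqb : q ≤ q' ∧ b ≠ z
    swap
    · exact Eventually.of_forall fun ω h1 h2 => (hqb ⟨h1, h2⟩).elim
    obtain ⟨hq, hb⟩ := hqb
    -- The finite-dimensional law at times `0 ≤ q ≤ q'` contains the factor `p (q' - q) z b`, which
    -- is zero because `{z}` is a closed set.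
    have h := hfd 2 (fun k => if k = 0 then 0 else if k = 1 then q else q')
      (fun k => if k = 0 then a else if k = 1 then z else b) rfl
      (monotone_nat_of_le_succ fun k => by rcases k with _ | _ | k <;> simp [hq]) rfl
    have hpz : p (q' - q) z b = 0 :=
      hp.eq_zero_of_notMem (s := {z}) (by simpa using hz) _ (by simp) (by simpa using hb)
    simp only [Finset.prod_range_succ, Finset.prod_range_zero, one_mul, zero_add, if_true,
      one_ne_zero, if_false, Nat.reduceAdd, OfNat.ofNat_ne_zero, OfNat.ofNat_ne_one, hpz,
      mul_zero] at h
    rw [measureReal_eq_zero_iff] at h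
    filter_upwards [h0, measure_eq_zero_iff_ae_notMem.1 h] with ω hω0 hω _ _ hz hb
    refine hω fun k hk => ?_
    interval_cases k
    · simpa using hω0
    · simpa using hz
    · simpa using hb
  filter_upwards [h1] with ω hω t u htu htz
  rcases htu.eq_or_lt with rfl | htu
  · exact htz
  obtain ⟨q, hqD, htq, hqu, hq⟩ := exists_dense_mem hD htu (hX.right_continuous ω t)
  obtain ⟨q', hqD', huq', -, hq'⟩ :=
    exists_dense_mem hD (lt_add_one u) (hX.right_continuous ω u)
  by_contra hne
  exact hω q hqD q' hqD' (X u ω) (hqu.trans huq').le hne (hq.trans htz) hq'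

/-- Multiplicative functionals of the chain sampled on a grid are given by matrix powers. -/
theorem IsMarkovChain.setIntegral_prod_grid [Countable S] [IsProbabilityMeasure P]
    (hX : IsMarkovChain R a P X) {p : ℝ≥0 → S → S → ℝ}
    (hfd : ∀ (n : ℕ) (t : ℕ → ℝ≥0) (b : ℕ → S), t 0 = 0 → Monotone t → b 0 = a →
      P.real {ω | ∀ k ≤ n, X (t k) ω = b k}
        = ∏ k ∈ Finset.range n, p (t (k + 1) - t k) (b k) (b (k + 1)))
    {s : Finset S} (hpath : ∀ᵐ ω ∂P, ∀ t, X t ω ∈ s) (h : ℝ≥0) {g : S → ℝ} {C : ℝ}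
    (hg0 : ∀ c, 0 ≤ g c) (hgC : ∀ c, g c ≤ C) (c : s) (l j : ℕ) (b : ℕ → S) (hb0 : b 0 = a)
    (hbj : b j ∈ s) :
    ∫ ω in {ω | ∀ k ≤ j, X (k * h) ω = b k},
        (∏ i ∈ Finset.range l, g (X ((j + 1 + i : ℕ) * h) ω)) *
          (if X ((j + l : ℕ) * h) ω = c then 1 else 0) ∂P
      = P.real {ω | ∀ k ≤ j, X (k * h) ω = b k} *
        ((Matrix.of fun x y : s => p h x y * g y) ^ l) ⟨b j, hbj⟩ c := by
  have hgrid : Monotone fun k : ℕ => (k : ℝ≥0) * h := fun i j hij => by dsimp only; gcongr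
  have hmeas : ∀ (j : ℕ) (b : ℕ → S), MeasurableSet {ω | ∀ k ≤ j, X (k * h) ω = b k} := by
    intro j b
    simp only [Set.ofPred_forall]
    exact MeasurableSet.iInter fun k => MeasurableSet.iInter fun _ => hX.measurable _ _
  -- Induction on the number of remaining steps with an arbitrary observed past `b 0, …, b j`.
  -- Splitting over the next state extends the past by one, so the product formula for cylinder
  -- probabilities replaces conditioning.
  induction l generalizing j b with
  | zero =>
    have h1 : ∀ ω ∈ {ω | ∀ k ≤ j, X (k * h) ω = b k},
        (∏ i ∈ Finset.range 0, g (X ((j + 1 + i : ℕ) * h) ω)) *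
          (if X ((j + 0 : ℕ) * h) ω = c then (1 : ℝ) else 0) = if b j = c then 1 else 0 := by
      intro ω hω
      rw [Finset.range_zero, Finset.prod_empty, one_mul, add_zero, hω j le_rfl]
    rw [setIntegral_congr_fun (hmeas j b) h1, setIntegral_const, smul_eq_mul, pow_zero,
      Matrix.one_apply]
    simp only [Subtype.ext_iff]
  | succ l ih =>
    let b' : S → ℕ → S := fun d => Function.update b (j + 1) d
    have hb'0 : ∀ d, b' d 0 = a := fun d => by simp [b', hb0]
    have hb'j : ∀ d, b' d (j + 1) = d := fun d => by simp [b']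
    have hb'k : ∀ d k, k ≤ j → b' d k = b k := fun d k hk => by
      simp only [b']; rw [Function.update_of_ne (by omega)]
    have hsplit : ∀ (d : S) ω, (∀ k ≤ j + 1, X (k * h) ω = b' d k) ↔
        (∀ k ≤ j, X (k * h) ω = b k) ∧ X ((j + 1 : ℕ) * h) ω = d := by
      intro d ω
      constructor
      · exact fun H => ⟨fun k hk => by rw [H k (by omega), hb'k d k hk],
          by rw [H _ le_rfl, hb'j]⟩
      · rintro ⟨H1, H2⟩ k hk
        rcases Nat.le_succ_iff.1 hk with hk | rfl
        · rw [H1 k hk, hb'k d k hk]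
        · rw [H2, hb'j]
    have hunion : {ω | ∀ k ≤ j, X (k * h) ω = b k} =ᵐ[P]
        ⋃ d ∈ s, {ω | ∀ k ≤ j + 1, X (k * h) ω = b' d k} := by
      filter_upwards [hpath] with ω hω
      refine propext ⟨fun H => ?_, fun H => ?_⟩
      · exact Set.mem_iUnion₂.2 ⟨_, hω _, (hsplit _ ω).2 ⟨H, rfl⟩⟩
      · obtain ⟨d, _, H⟩ := Set.mem_iUnion₂.1 H
        exact ((hsplit d ω).1 H).1
    have hprob : ∀ d, P.real {ω | ∀ k ≤ j + 1, X (k * h) ω = b' d k} =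
        P.real {ω | ∀ k ≤ j, X (k * h) ω = b k} * p h (b j) d := by
      intro d
      rw [hfd (j + 1) _ (b' d) (by simp) hgrid (hb'0 d), hfd j _ b (by simp) hgrid hb0,
        Finset.prod_range_succ, hb'j, hb'k d j le_rfl]
      congr 1
      · refine Finset.prod_congr rfl fun k hk => ?_
        have := Finset.mem_range.1 hk
        rw [hb'k d k (by omega), hb'k d (k + 1) (by omega)]
      · congr 1
        push_cast
        rw [add_mul, one_mul, add_tsub_cancel_left]
    rw [setIntegral_congr_set hunion, integral_biUnion_finset]
    · rw [pow_succ', Matrix.mul_apply, Finset.mul_sum, ← Finset.sum_coe_sort]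
      refine Finset.sum_congr rfl fun d _ => ?_
      have h1 : ∀ ω ∈ {ω | ∀ k ≤ j + 1, X (k * h) ω = b' d k},
          (∏ i ∈ Finset.range (l + 1), g (X ((j + 1 + i : ℕ) * h) ω)) *
            (if X ((j + (l + 1) : ℕ) * h) ω = c then (1 : ℝ) else 0) =
          g d * ((∏ i ∈ Finset.range l, g (X ((j + 1 + 1 + i : ℕ) * h) ω)) *
            (if X ((j + 1 + l : ℕ) * h) ω = c then 1 else 0)) := by
        intro ω hω
        have h2 := ((hsplit d ω).1 hω).2
        rw [Finset.prod_range_succ', add_zero, h2, ← add_assoc, add_right_comm j l 1]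
        simp only [add_assoc, add_comm 1]
        ring
      have hdj : b' d (j + 1) ∈ s := by rw [hb'j]; exact d.2
      rw [setIntegral_congr_fun (hmeas _ _) h1, integral_const_mul,
        ih (j + 1) (b' d) (hb'0 d) hdj, hprob, Matrix.of_apply]
      have h3 : (⟨b' d (j + 1), hdj⟩ : s) = d := Subtype.ext (hb'j d)
      rw [h3]
      ring
    · exact fun d _ => hmeas _ _
    · intro d _ d' _ hdd'
      refine Set.disjoint_left.2 fun ω h1 h2 => hdd' ?_
      rw [← ((hsplit d ω).1 h1).2, ((hsplit d' ω).1 h2).2]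
    · intro d _
      refine Integrable.integrableOn (Integrable.of_bound (C := C ^ (l + 1)) ?_ ?_)
      · refine Measurable.aestronglyMeasurable (Measurable.mul ?_ ?_)
        · exact Finset.measurable_prod _ fun i _ => hX.measurable_comp _ g
        · exact hX.measurable_comp _ fun x => if x = (c : S) then (1 : ℝ) else 0
      · refine Eventually.of_forall fun ω => ?_
        have h1 : ∏ i ∈ Finset.range (l + 1), g (X ((j + 1 + i : ℕ) * h) ω) ≤ C ^ (l + 1) := by
          refine (Finset.prod_le_prod (fun i _ => hg0 _) fun i _ => hgC _).trans (by simp)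
        have h0 : 0 ≤ ∏ i ∈ Finset.range (l + 1), g (X ((j + 1 + i : ℕ) * h) ω) :=
          Finset.prod_nonneg fun i _ => hg0 _
        rw [norm_mul, Real.norm_of_nonneg h0]
        split_ifs
        · simpa using h1
        · simpa using h0.trans h1

end Grid

/-! ### The Feynman–Kac formula at a fixed time -/

section FeynmanKac

open scoped Matrix.Norms.Operator

variable {S : Type*} [DecidableEq S] {R : S → S → ℝ} {a : S}
  {Ω : Type*} [MeasurableSpace Ω] {P : Measure Ω} {X : ℝ≥0 → Ω → S}

theorem tendsto_matrix_of {ι : Type*} [Fintype ι] {α : Type*} {l : Filter α}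
    {f : α → Matrix ι ι ℝ} {M : Matrix ι ι ℝ}
    (h : ∀ i j, Tendsto (fun x => f x i j) l (𝓝 (M i j))) : Tendsto f l (𝓝 M) :=
  tendsto_pi_nhds.2 fun i => tendsto_pi_nhds.2 fun j => h i j

/-- The generator of `h ↦ p_h diag(e^{-h k})`. -/
theorem IsTransitionFunction.tendsto_killed {p : ℝ≥0 → S → S → ℝ} (hp : IsTransitionFunction R p)
    (s : Finset S) (k : S → ℝ) :
    Tendsto (fun h : ℝ => h⁻¹ • ((Matrix.of fun x y : s =>
        p h.toNNReal x y * Real.exp (-(h * k y))) - 1)) (𝓝[>] 0)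
      (𝓝 (Matrix.of fun x y : s => R x y - if (x : S) = y then k x else 0)) := by
  refine tendsto_matrix_of fun x y => ?_
  have h1 := hp.tendsto_rate (x : S) (y : S)
  have h2 : HasDerivAt (fun h : ℝ => Real.exp (-(h * k y))) (-k y) 0 := by
    have := (((hasDerivAt_id (0 : ℝ)).mul_const (k y)).neg).exp
    simpa using this
  have h3 := h2.continuousAt.tendsto.mono_left (nhdsWithin_le_nhds (s := Set.Ioi 0))
  have h4 := h2.tendsto_slope_zero_right
  -- Product rule: `p e - δ = (p - δ) e + δ (e - 1)` with `e = exp(-h k)`.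
  have h5 := (h1.mul h3).add (h4.const_mul (if (x : S) = y then 1 else 0))
  have h6 : R x y * Real.exp (-(0 * k y)) + (if (x : S) = y then 1 else 0) * -k y =
      R x y - if (x : S) = y then k x else 0 := by
    split_ifs with h
    · rw [h]; simp [sub_eq_add_neg]
    · simp
  rw [h6] at h5
  refine h5.congr fun h => ?_
  simp only [Matrix.smul_apply, Matrix.sub_apply, Matrix.of_apply, Matrix.one_apply, smul_eq_mul,
    zero_add, zero_mul, neg_zero, Real.exp_zero, Subtype.ext_iff]
  ring

theorem continuousWithinAt_path {S : Type*} {X : ℝ≥0 → S} (hX : ∀ t, ∀ᶠ s in 𝓝[≥] t, X s = X t)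
    (k : S → ℝ) (s : ℝ) : ContinuousWithinAt (fun s : ℝ => k (X s.toNNReal)) (Set.Ici s) s := by
  have h1 : Tendsto Real.toNNReal (𝓝[≥] s) (𝓝[≥] s.toNNReal) :=
    tendsto_nhdsWithin_iff.2 ⟨(continuous_real_toNNReal.tendsto s).mono_left nhdsWithin_le_nhds,
      eventually_nhdsWithin_of_forall fun u hu => Real.toNNReal_le_toNNReal hu⟩
  refine tendsto_const_nhds.congr' ?_
  filter_upwards [h1.eventually (hX s.toNNReal)] with u hu
  rw [hu]

/-- The **Feynman–Kac formula** for a chain confined to a finite set. -/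
theorem IsMarkovChain.feynmanKac [Countable S] [IsProbabilityMeasure P] (hX : IsMarkovChain R a P X)
    {s : Finset S} (ha : a ∈ s) (hs : ∀ a ∈ s, ∑ b ∈ s, R a b = 0) (k : S → ℝ) (c : s) {t : ℝ}
    (ht : 0 < t) :
    Integrable (fun ω => Real.exp (-∫ u in (0 : ℝ)..t, k (X u.toNNReal ω)) *
        (if X t.toNNReal ω = c then 1 else 0)) P ∧
    ∫ ω, Real.exp (-∫ u in (0 : ℝ)..t, k (X u.toNNReal ω)) *
        (if X t.toNNReal ω = c then 1 else 0) ∂P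
      = NormedSpace.exp (t • Matrix.of fun x y : s => R x y - if (x : S) = y then k x else 0)
          ⟨a, ha⟩ c := by
  have : Nonempty s := ⟨⟨a, ha⟩⟩
  have hpath := hX.ae_forall_mem ha hs
  obtain ⟨p, hp, h0, hfd⟩ := hX.exists_transition
  obtain ⟨C, hC⟩ : ∃ C : ℝ, ∀ x ∈ s, |k x| ≤ C := by
    obtain ⟨C, hC⟩ := (s.image fun x => |k x|).bddAbove
    exact ⟨C, fun x hx => hC (by simpa using ⟨x, hx, rfl⟩)⟩
  have hC0 : 0 ≤ C := (abs_nonneg _).trans (hC a ha)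
  -- Truncation makes the rate bounded everywhere and changes nothing along paths, which almost
  -- surely stay in `s`.
  let k' : S → ℝ := fun x => if x ∈ s then k x else 0
  have hk' : ∀ x, |k' x| ≤ C := fun x => by
    simp only [k']; split_ifs with hx
    · exact hC x hx
    · simpa using hC0
  let F : ℕ → Ω → ℝ := fun n ω =>
    (∏ i ∈ Finset.range n, Real.exp (-(t / n * k' (X ((0 + 1 + i : ℕ) * (t / n).toNNReal) ω)))) *
      (if X ((0 + n : ℕ) * (t / n).toNNReal) ω = c then 1 else 0)
  have hFm : ∀ n, AEStronglyMeasurable (F n) P := fun n => by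
    refine Measurable.aestronglyMeasurable (Measurable.mul ?_ ?_)
    · exact Finset.measurable_prod _ fun i _ =>
        hX.measurable_comp _ fun x => Real.exp (-(t / n * k' x))
    · exact hX.measurable_comp _ fun x => if x = (c : S) then (1 : ℝ) else 0
  have hFint : ∀ n, ∫ ω, F n ω ∂P =
      ((Matrix.of fun x y : s => p (t / n).toNNReal x y * Real.exp (-(t / n * k' y))) ^ n)
        ⟨a, ha⟩ c := by
    intro n
    have h1 := hX.setIntegral_prod_grid hfd hpath (t / n).toNNReal
      (g := fun x => Real.exp (-(t / n * k' x))) (C := Real.exp (t / n * C))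
      (fun _ => (Real.exp_pos _).le) (fun x => by
        refine Real.exp_le_exp.2 ?_
        rw [← mul_neg]
        exact mul_le_mul_of_nonneg_left ((neg_le_abs _).trans (hk' x)) (by positivity))
      c n 0 (fun _ => a) rfl ha
    have h2 : {ω | ∀ j ≤ 0, X ((j : ℕ) * (t / n).toNNReal) ω = a} =ᵐ[P] Set.univ := by
      filter_upwards [h0] with ω hω
      refine eq_true fun j hj => ?_
      rw [Nat.le_zero.1 hj, Nat.cast_zero, zero_mul, hω]
    rw [setIntegral_congr_set h2, measureReal_congr h2, setIntegral_univ, probReal_univ,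
      one_mul] at h1
    exact h1
  have hFlim : ∀ᵐ ω ∂P, Tendsto (fun n => F n ω) atTop
      (𝓝 (Real.exp (-∫ u in (0 : ℝ)..t, k (X u.toNNReal ω)) *
        (if X t.toNNReal ω = c then 1 else 0))) := by
    filter_upwards [hpath] with ω hω
    have h1 := tendsto_riemannSum_right ht (f := fun u => k' (X u.toNNReal ω)) (fun u => hk' _)
      fun u _ => continuousWithinAt_path (X := fun t => X t ω) (hX.right_continuous ω) k' u
    have h2 : ∀ v, k' (X v ω) = k (X v ω) := fun v => if_pos (hω v)
    simp only [h2] at h1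
    refine ((Real.continuous_exp.tendsto _).comp h1.neg).mul_const _ |>.congr' ?_
    filter_upwards [eventually_gt_atTop 0] with n hn
    have hn' : (0 : ℝ) < n := Nat.cast_pos.2 hn
    have h3 : ((n : ℕ) : ℝ≥0) * (t / n).toNNReal = t.toNNReal := by
      rw [← Real.toNNReal_natCast, ← Real.toNNReal_mul hn'.le, mul_div_cancel₀ _ hn'.ne']
    simp only [F, zero_add, h3, Function.comp_apply, h2]
    rw [← Real.exp_sum, Finset.sum_neg_distrib, Finset.mul_sum]
    have h4 : ∀ i : ℕ, ((i + 1 : ℕ) * (t / (n : ℝ))).toNNReal =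
        ((1 + i : ℕ) : ℝ≥0) * (t / n).toNNReal := fun i => by
      rw [Real.toNNReal_mul (by positivity), Real.toNNReal_natCast, add_comm i 1]
    simp only [h4]
  have hFbound : ∀ n : ℕ, ∀ᵐ ω ∂P, ‖F n ω‖ ≤ Real.exp (t * C) := by
    intro n
    refine Eventually.of_forall fun ω => ?_
    have h1 : ∏ i ∈ Finset.range n,
        Real.exp (-(t / n * k' (X ((0 + 1 + i : ℕ) * (t / n).toNNReal) ω))) ≤ Real.exp (t * C) := by
      rcases Nat.eq_zero_or_pos n with rfl | hn
      · simpa using mul_nonneg ht.le hC0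
      have hn' : (0 : ℝ) < n := Nat.cast_pos.2 hn
      rw [← Real.exp_sum]
      refine Real.exp_le_exp.2 ((Finset.sum_le_sum (g := fun _ => t / n * C) fun i _ => ?_).trans
        (le_of_eq ?_))
      · rw [← mul_neg]
        exact mul_le_mul_of_nonneg_left ((neg_le_abs _).trans (hk' _)) (by positivity)
      · rw [Finset.sum_const, Finset.card_range, nsmul_eq_mul]
        field_simp
    rw [norm_mul, Real.norm_of_nonneg (Finset.prod_nonneg fun i _ => (Real.exp_pos _).le)]
    split_ifs
    · simpa using h1
    · simpa using (Real.exp_pos _).le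
  refine ⟨Integrable.of_bound (C := Real.exp (t * C))
    (aestronglyMeasurable_of_tendsto_ae atTop hFm hFlim) ?_, ?_⟩
  · filter_upwards [hFlim, ae_all_iff.2 hFbound] with ω h1 h2
    exact le_of_tendsto h1.norm (Eventually.of_forall h2)
  have hint := tendsto_integral_of_dominated_convergence (fun _ => Real.exp (t * C)) hFm
    (integrable_const _) hFbound hFlim
  refine tendsto_nhds_unique hint ?_
  have h1 := tendsto_pow_exp (hp.tendsto_killed s k') ht
  have h2 := ((continuous_id.matrix_elem (⟨a, ha⟩ : s) c).tendsto _).comp h1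
  simp only [hFint]
  have h3 : (Matrix.of fun x y : s => R x y - if (x : S) = y then k' x else 0) =
      Matrix.of fun x y : s => R x y - if (x : S) = y then k x else 0 := by
    ext x y
    simp only [Matrix.of_apply, k', if_pos x.2]
  rw [h3] at h2
  exact h2

end FeynmanKac

/-! ### Passage to the absorption time -/

section HittingTime

theorem hittingTime_le {S Ω : Type*} {X : ℝ≥0 → Ω → S} {z : S} {ω : Ω} {t : ℝ≥0} (ht : 0 < t)
    (h : X t ω = z) : hittingTime X z ω ≤ t :=
  sInf_le ⟨t, ⟨ht, h⟩, rfl⟩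

theorem eq_of_hittingTime_lt {S Ω : Type*} {X : ℝ≥0 → Ω → S} {z : S} {ω : Ω}
    (habs : ∀ t u, t ≤ u → X t ω = z → X u ω = z) {t : ℝ≥0} (h : hittingTime X z ω < t) :
    X t ω = z := by
  obtain ⟨_, ⟨u, ⟨-, hu⟩, rfl⟩, hut⟩ := sInf_lt_iff.1 h
  exact habs u t (ENNReal.coe_le_coe.1 hut.le) hu

theorem integral_eq_integral_hittingTime {S Ω : Type*} {X : ℝ≥0 → Ω → S} {z : S} {ω : Ω}
    (habs : ∀ t u, t ≤ u → X t ω = z → X u ω = z) {k : S → ℝ} (hk : k z = 0) {t : ℝ≥0}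
    (ht : 0 < t) (h : X t ω = z) :
    ∫ u in (0 : ℝ)..t, k (X u.toNNReal ω) =
      ∫ u in (0 : ℝ)..(hittingTime X z ω).toReal, k (X u.toNNReal ω) := by
  have hle := hittingTime_le ht h
  have hfin : hittingTime X z ω ≠ ∞ := (hle.trans_lt ENNReal.coe_lt_top).ne
  have hle' : (hittingTime X z ω).toReal ≤ t := ENNReal.toReal_le_coe_of_le_coe hle
  rw [intervalIntegral.integral_of_le t.coe_nonneg,
    intervalIntegral.integral_of_le ENNReal.toReal_nonneg]
  refine setIntegral_eq_of_subset_of_forall_sdiff_eq_zero measurableSet_Ioc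
    (Set.Ioc_subset_Ioc_right hle') fun u hu => ?_
  have hu1 : (hittingTime X z ω).toReal < u := by
    by_contra hlt
    exact hu.2 ⟨hu.1.1, not_lt.1 hlt⟩
  rw [eq_of_hittingTime_lt habs, hk]
  rw [← ENNReal.ofReal_toReal hfin]
  exact (ENNReal.ofReal_lt_ofReal_iff hu.1.1).2 hu1

variable {S : Type*} [DecidableEq S] {R : S → S → ℝ} {a : S}
  {Ω : Type*} [MeasurableSpace Ω] {P : Measure Ω} {X : ℝ≥0 → Ω → S}

/-- If the chain is absorbed in `z` with probability one, the Feynman–Kac functional up to the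
absorption time is the limit of the functionals up to fixed times. -/
theorem IsMarkovChain.feynmanKac_hittingTime [Countable S] [IsProbabilityMeasure P]
    (hX : IsMarkovChain R a P X) {s : Finset S} (ha : a ∈ s)
    (hs : ∀ a ∈ s, ∑ b ∈ s, R a b = 0) {k : S → ℝ} {z : S} (hz : z ∈ s)
    (hRz : R z z = 0) (hk : k z = 0)
    (hR : Tendsto (fun t : ℝ≥0 => NormedSpace.exp ((t : ℝ) • Matrix.of fun x y : s => R x y)
      ⟨a, ha⟩ ⟨z, hz⟩) atTop (𝓝 1)) {M : ℝ}
    (hM : Tendsto (fun t : ℝ≥0 => NormedSpace.exp ((t : ℝ) • Matrix.of fun x y : s =>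
      R x y - if (x : S) = y then k x else 0) ⟨a, ha⟩ ⟨z, hz⟩) atTop (𝓝 M)) :
    (∀ᵐ ω ∂P, hittingTime X z ω < ∞) ∧
    Integrable (fun ω => Real.exp (-∫ u in (0 : ℝ)..(hittingTime X z ω).toReal,
      k (X u.toNNReal ω))) P ∧
    ∫ ω, Real.exp (-∫ u in (0 : ℝ)..(hittingTime X z ω).toReal, k (X u.toNNReal ω)) ∂P = M := by
  -- Times `n + 1` rather than `n`, because the hitting time ranges over strictly positive times.
  have hnat : Tendsto (fun n : ℕ => ((n + 1 : ℕ) : ℝ≥0)) atTop atTop :=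
    tendsto_natCast_atTop_atTop.comp (tendsto_add_atTop_nat 1)
  have hpos : ∀ n : ℕ, (0 : ℝ≥0) < (n + 1 : ℕ) := fun n => Nat.cast_pos.2 n.succ_pos
  have hprob : ∀ t : ℝ≥0, 0 < t → P.real {ω | X t ω = z} =
      NormedSpace.exp ((t : ℝ) • Matrix.of fun x y : s => R x y) ⟨a, ha⟩ ⟨z, hz⟩ := by
    intro t ht
    have h1 := (hX.feynmanKac ha hs (fun _ => 0) ⟨z, hz⟩ (NNReal.coe_pos.2 ht)).2
    simp only [intervalIntegral.integral_zero, neg_zero, Real.exp_zero, one_mul,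
      Real.toNNReal_coe, ite_self, sub_zero] at h1
    rw [← h1, ← integral_indicator_one (hX.measurable t z)]
    refine integral_congr_ae (Eventually.of_forall fun ω => ?_)
    simp [Set.indicator_apply]
  have hex : ∀ᵐ ω ∂P, ∃ n : ℕ, X (n + 1 : ℕ) ω = z := by
    have h1 : ∀ n : ℕ, P.real {ω | X (n + 1 : ℕ) ω = z} ≤ P.real {ω | ∃ n : ℕ, X (n + 1 : ℕ) ω = z} :=
      fun n => measureReal_mono fun ω h => ⟨n, h⟩
    have h2 : 1 ≤ P.real {ω | ∃ n : ℕ, X (n + 1 : ℕ) ω = z} := by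
      refine le_of_tendsto (hR.comp hnat) (Eventually.of_forall fun n => ?_)
      rw [Function.comp_apply, ← hprob _ (hpos n)]
      exact h1 n
    have h3 : MeasurableSet {ω | ∃ n : ℕ, X (n + 1 : ℕ) ω = z} := by
      rw [Set.ofPred_exists]
      exact MeasurableSet.iUnion fun n => hX.measurable _ _
    have h4 : P {ω | ∃ n : ℕ, X (n + 1 : ℕ) ω = z} = 1 := by
      rw [← ENNReal.toReal_eq_one_iff]
      exact le_antisymm measureReal_le_one h2
    exact (mem_ae_iff_prob_eq_one h3).2 h4
  have habs := hX.ae_absorbed hRz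
  let F : Ω → ℝ := fun ω =>
    Real.exp (-∫ u in (0 : ℝ)..(hittingTime X z ω).toReal, k (X u.toNNReal ω))
  let Y : ℕ → Ω → ℝ := fun n ω =>
    Real.exp (-∫ u in (0 : ℝ)..((n + 1 : ℕ) : ℝ≥0), k (X u.toNNReal ω)) *
      (if X ((((n + 1 : ℕ) : ℝ≥0) : ℝ).toNNReal) ω = z then 1 else 0)
  have hY := fun n : ℕ => hX.feynmanKac ha hs k ⟨z, hz⟩ (NNReal.coe_pos.2 (hpos n))
  have hYF : ∀ᵐ ω ∂P, ∀ n, X (n + 1 : ℕ) ω = z → Y n ω = F ω := by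
    filter_upwards [habs] with ω hω n hn
    simp only [Y, F, Real.toNNReal_coe, if_pos hn, mul_one]
    rw [integral_eq_integral_hittingTime hω hk (hpos n) hn]
  have hY0 : ∀ n ω, X (n + 1 : ℕ) ω ≠ z → Y n ω = 0 := fun n ω h => by
    simp only [Y, Real.toNNReal_coe, if_neg h, mul_zero]
  have hlim : ∀ᵐ ω ∂P, Tendsto (fun n => Y n ω) atTop (𝓝 (F ω)) := by
    filter_upwards [hYF, habs, hex] with ω h1 h2 ⟨m, hm⟩
    refine tendsto_const_nhds.congr' ?_
    filter_upwards [eventually_ge_atTop m] with n hn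
    exact (h1 n (h2 _ _ (by gcongr) hm)).symm
  -- Almost surely `Y n` is `F` restricted to absorption by time `n + 1`, so the limit `F` itself
  -- dominates.
  have hbound : ∀ n, ∀ᵐ ω ∂P, ‖Y n ω‖ ≤ F ω := by
    intro n
    filter_upwards [hYF] with ω h1
    by_cases h : X (n + 1 : ℕ) ω = z
    · rw [h1 n h, Real.norm_of_nonneg (Real.exp_pos _).le]
    · rw [hY0 n ω h, norm_zero]
      exact (Real.exp_pos _).le
  have hYint : Tendsto (fun n => ∫ ω, Y n ω ∂P) atTop (𝓝 M) := by
    refine (hM.comp hnat).congr fun n => ?_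
    exact (hY n).2.symm
  have hFm : AEStronglyMeasurable F P :=
    aestronglyMeasurable_of_tendsto_ae atTop (fun n => (hY n).1.1) hlim
  -- Fatou: the integrals of the nonnegative `Y n` converge to `M`.
  have hFi : Integrable F P := by
    refine ⟨hFm, ?_⟩
    have h1 : ∀ n, ∫⁻ ω, ‖Y n ω‖ₑ ∂P = ENNReal.ofReal (∫ ω, Y n ω ∂P) := fun n => by
      rw [← ofReal_integral_norm_eq_lintegral_enorm (hY n).1]
      congr 1
      refine integral_congr_ae (Eventually.of_forall fun ω => Real.norm_of_nonneg ?_)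
      exact mul_nonneg (Real.exp_pos _).le (by split_ifs <;> norm_num)
    have h2 : Tendsto (fun n => ∫⁻ ω, ‖Y n ω‖ₑ ∂P) atTop (𝓝 (ENNReal.ofReal M)) := by
      simp only [h1]
      exact (ENNReal.continuous_ofReal.tendsto M).comp hYint
    calc ∫⁻ ω, ‖F ω‖ₑ ∂P = ∫⁻ ω, liminf (fun n => ‖Y n ω‖ₑ) atTop ∂P :=
          lintegral_congr_ae (hlim.mono fun ω h => h.enorm.liminf_eq.symm)
      _ ≤ liminf (fun n => ∫⁻ ω, ‖Y n ω‖ₑ ∂P) atTop :=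
          lintegral_liminf_le' fun n => (hY n).1.1.enorm
      _ = ENNReal.ofReal M := h2.liminf_eq
      _ < ∞ := ENNReal.ofReal_lt_top
  refine ⟨?_, hFi, ?_⟩
  · filter_upwards [hex] with ω ⟨n, hn⟩
    exact (hittingTime_le (hpos n) hn).trans_lt ENNReal.coe_lt_top
  · exact tendsto_nhds_unique
      (tendsto_integral_of_dominated_convergence F (fun n => (hY n).1.1) hFi hbound hlim) hYint

end HittingTime

/-! ### Adjoint semigroup and stationarity -/

section Adjoint

theorem eq_of_forall_integral_continuousMap_eq {K : Type*} [TopologicalSpace K]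
    [HasOuterApproxClosed K] [MeasurableSpace K] [BorelSpace K]
    {μ ν : ProbabilityMeasure K}
    (h : ∀ f : C(K, ℝ), ∫ x, f x ∂(μ : Measure K) = ∫ x, f x ∂(ν : Measure K)) : μ = ν := by
  refine Subtype.ext ?_
  have h1 : IsFiniteMeasure (μ : Measure K) := inferInstance
  have h2 : IsFiniteMeasure (ν : Measure K) := inferInstance
  exact ext_of_forall_integral_eq_of_IsFiniteMeasure (μ := (μ : Measure K))
    (ν := (ν : Measure K)) fun f => h f.toContinuousMap

variable {K : Type*} [TopologicalSpace K] [CompactSpace K]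

theorem MarkovSemigroup.op_le_one (T : MarkovSemigroup K) (t : ℝ≥0) {f : C(K, ℝ)} (hf : f ≤ 1)
    (x : K) : T.op t f x ≤ 1 := by
  have h := T.op_nonneg t (1 - f) (sub_nonneg.2 hf) x
  rw [map_sub, T.op_one] at h
  simpa using h

variable [MeasurableSpace K] [BorelSpace K]

theorem tendsto_integral_continuousMap {α : Type*} {l : Filter α} {μ : α → ProbabilityMeasure K}
    {ν : ProbabilityMeasure K} (h : Tendsto μ l (𝓝 ν)) (f : C(K, ℝ)) :
    Tendsto (fun i => ∫ x, f x ∂(μ i : Measure K)) l (𝓝 (∫ x, f x ∂(ν : Measure K))) :=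
  ProbabilityMeasure.tendsto_iff_forall_integral_tendsto.1 h
    (BoundedContinuousFunction.mkOfCompact f)

theorem integrable_continuousMap (μ : ProbabilityMeasure K) (f : C(K, ℝ)) :
    Integrable (fun x => f x) (μ : Measure K) :=
  f.continuous.integrable_of_hasCompactSupport (HasCompactSupport.of_compactSpace _)

variable [T2Space K]

/-- A limit of the distributions at large times is stationary. -/
theorem MarkovSemigroup.isStationary_of_tendsto [HasOuterApproxClosed K] (T : MarkovSemigroup K)
    {x : K} {ν : ProbabilityMeasure K}
    (h : Tendsto (fun t : ℝ≥0 => T.adjoint t (diracProba x)) atTop (𝓝 ν)) : T.IsStationary ν := by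
  have hop : ∀ (t : ℝ≥0) (f : C(K, ℝ)),
      ∫ y, f y ∂(T.adjoint t (diracProba x) : Measure K) = T.op t f x := fun t f => by
    rw [T.integral_adjoint]
    exact integral_dirac _ _
  intro s
  refine eq_of_forall_integral_continuousMap_eq fun f => ?_
  rw [T.integral_adjoint]
  refine tendsto_nhds_unique (tendsto_integral_continuousMap h (T.op s f)) ?_
  have h1 := (tendsto_integral_continuousMap h f).comp
    (tendsto_atTop_mono (fun t : ℝ≥0 => le_self_add (b := s)) tendsto_id)
  refine h1.congr fun t => ?_
  rw [Function.comp_apply]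
  change ∫ y, f y ∂(T.adjoint (t + s) (diracProba x) : Measure K) = _
  rw [hop, hop, T.op_add]

end Adjoint

/-! ### Moments determine measures on the simplex -/

section Moments

variable {V : Type*} [Fintype V]

/-- The monomial `x ^ a` as a continuous function on the simplex. -/
def monomialMap (a : V → ℕ) : C(Simplex V, ℝ) :=
  restrict (monomialFun a) (contDiff_monomialFun a (n := 2)).continuous

theorem monomialMap_apply (a : V → ℕ) (x : Simplex V) : monomialMap a x = monomialFun a x := rfl

theorem monomialMap_zero : monomialMap (0 : V → ℕ) = 1 := by
  ext x
  exact monomialFun_zero _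

theorem monomialMap_nonneg (a : V → ℕ) (x : Simplex V) : 0 ≤ monomialMap a x :=
  Finset.prod_nonneg fun i _ => pow_nonneg (x.2.1 i) _

theorem monomialMap_le_one (a : V → ℕ) : monomialMap a ≤ 1 := fun x =>
  Finset.prod_le_one (fun i _ => pow_nonneg (x.2.1 i) _)
    fun i _ => pow_le_one₀ (x.2.1 i) (mem_Icc_of_mem_stdSimplex x.2 i).2

/-- Probability measures on the simplex are determined by their moments. -/
theorem eq_of_forall_moment_eq {μ ν : ProbabilityMeasure (Simplex V)}
    (h : ∀ a : V → ℕ, ∫ x, monomialMap a x ∂(μ : Measure (Simplex V)) =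
      ∫ x, monomialMap a x ∂(ν : Measure (Simplex V))) : μ = ν := by
  classical
  let coord : V → C(Simplex V, ℝ) := fun i => monomialMap (Pi.single i 1)
  let A : Subalgebra ℝ C(Simplex V, ℝ) := Algebra.adjoin ℝ (Set.range coord)
  have hA : A.SeparatesPoints := by
    intro x y hxy
    obtain ⟨i, hi⟩ := Function.ne_iff.1 fun hxy' => hxy (Subtype.ext hxy')
    refine ⟨coord i, ⟨coord i, Algebra.subset_adjoin ⟨i, rfl⟩, rfl⟩, ?_⟩
    simp only [coord, monomialMap_apply, monomialFun_single]
    exact hi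
  -- Products of coordinates are monomials, so the algebra they generate is the linear span of
  -- monomials.
  have hclosure : ∀ f ∈ Submonoid.closure (Set.range coord), ∃ a, f = monomialMap a := by
    intro f hf
    induction hf using Submonoid.closure_induction with
    | mem f hf => obtain ⟨i, rfl⟩ := hf; exact ⟨_, rfl⟩
    | one => exact ⟨0, monomialMap_zero.symm⟩
    | mul f g _ _ ihf ihg =>
      obtain ⟨a, rfl⟩ := ihf
      obtain ⟨b, rfl⟩ := ihg
      refine ⟨a + b, ?_⟩
      ext x
      exact (monomialFun_add a b x).symm
  have hmem : ∀ f ∈ A, ∫ x, f x ∂(μ : Measure (Simplex V)) = ∫ x, f x ∂(ν : Measure (Simplex V)) := by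
    intro f hf
    rw [← Subalgebra.mem_toSubmodule, Algebra.adjoin_eq_span] at hf
    induction hf using Submodule.span_induction with
    | mem f hf => obtain ⟨a, rfl⟩ := hclosure f hf; exact h a
    | zero => simp
    | add f g _ _ ihf ihg =>
      simp only [ContinuousMap.add_apply]
      rw [integral_add (integrable_continuousMap μ f) (integrable_continuousMap μ g),
        integral_add (integrable_continuousMap ν f) (integrable_continuousMap ν g), ihf, ihg]
    | smul c f _ ihf =>
      simp only [ContinuousMap.smul_apply, smul_eq_mul]
      rw [integral_const_mul, integral_const_mul, ihf]
  refine eq_of_forall_integral_continuousMap_eq fun f => ?_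
  have hcont : ∀ μ : ProbabilityMeasure (Simplex V),
      Continuous fun f : C(Simplex V, ℝ) => ∫ x, f x ∂(μ : Measure (Simplex V)) := fun μ => by
    refine (LipschitzWith.of_dist_le_mul (K := 1) fun f g => ?_).continuous
    rw [dist_eq_norm, ← integral_sub (integrable_continuousMap μ f) (integrable_continuousMap μ g),
      NNReal.coe_one, one_mul]
    refine (norm_integral_le_of_norm_le_const (C := dist f g)
      (Eventually.of_forall fun x => ?_)).trans (by simp)
    rw [← dist_eq_norm]
    exact ContinuousMap.dist_apply_le_dist x
  have hcl : IsClosed {f : C(Simplex V, ℝ) | ∫ x, f x ∂(μ : Measure (Simplex V)) =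
      ∫ x, f x ∂(ν : Measure (Simplex V))} := isClosed_eq (hcont μ) (hcont ν)
  have hf := ContinuousMap.continuousMap_mem_subalgebra_closure_of_separatesPoints A hA f
  exact closure_minimal hmem hcl hf

end Moments

/-! ### Semigroup duality in bounded degree and long-time limits -/

section LevelSet

variable {V : Type*} [Fintype V] [DecidableEq V]

/-- The multi-indices of degree at most `N`. -/
def levelSet (V : Type*) [Fintype V] [DecidableEq V] (N : ℕ) : Finset (V → ℕ) :=
  (Fintype.piFinset fun _ => Finset.range (N + 1)).filter fun a => ∑ i, a i ≤ N

theorem mem_levelSet {N : ℕ} {a : V → ℕ} : a ∈ levelSet V N ↔ ∑ i, a i ≤ N := by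
  rw [levelSet, Finset.mem_filter, and_iff_right_iff_imp, Fintype.mem_piFinset]
  intro h i
  rw [Finset.mem_range_succ_iff]
  exact (Finset.single_le_sum (fun _ _ => Nat.zero_le _) (Finset.mem_univ i)).trans h

theorem zero_mem_levelSet (N : ℕ) : (0 : V → ℕ) ∈ levelSet V N := mem_levelSet.2 (by simp)

theorem levelSet_closed {N : ℕ} {a : V → ℕ} (ha : a ∈ levelSet V N) (b : V → ℕ)
    (h : ∑ i, b i ≤ ∑ i, a i) : b ∈ levelSet V N :=
  mem_levelSet.2 (h.trans (mem_levelSet.1 ha))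

variable (G : SimpleGraph V) [DecidableRel G.Adj]

theorem sum_rateMatrix_levelSet (α : ℝ) {N : ℕ} {a : V → ℕ} (ha : a ∈ levelSet V N) :
    ∑ b ∈ levelSet V N, rateMatrix G α a b = 0 := by
  have := sum_rateMatrix_mul G α (levelSet_closed ha) fun _ => 1
  simpa using this

/-- The killed rate matrix on multi-indices of degree at most `N`. -/
def killedMatrix (α : ℝ) (N : ℕ) : Matrix (levelSet V N) (levelSet V N) ℝ :=
  Matrix.of fun x y => rateMatrix G α x y - if (x : V → ℕ) = y then killingRate G α x else 0

theorem killedMatrix_apply (α : ℝ) (N : ℕ) (x y : levelSet V N) :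
    killedMatrix G α N x y = killedRate G α x y := rfl

theorem killedMatrix_nonneg {α : ℝ} (hα : 0 < α) (N : ℕ) (x y : levelSet V N) (h : x ≠ y) :
    0 ≤ killedMatrix G α N x y :=
  killedRate_nonneg G hα.le fun h' => h (Subtype.ext h')

open scoped Matrix.Norms.Operator in
/-- **Duality** of the diffusion and the killed chain. -/
theorem op_monomialMap {α : ℝ} {T : MarkovSemigroup (Simplex V)} (hT : IsDiffusionSemigroup G α T)
    {N : ℕ} (a : levelSet V N) (t : ℝ≥0) (x : Simplex V) :
    T.op t (monomialMap a) x =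
      ∑ b, NormedSpace.exp ((t : ℝ) • killedMatrix G α N) a b * monomialMap (b : V → ℕ) x := by
  -- At a fixed point `x`, the values of all `T_s x^b` of degree at most `N` solve a closed linear
  -- system.
  let u : ℝ → levelSet V N → ℝ := fun s b => T.op s.toNNReal (monomialMap (b : V → ℕ)) x
  have hcont : ∀ f : C(Simplex V, ℝ), Continuous fun s : ℝ => T.op s.toNNReal f := fun f =>
    (T.strongly_continuous f).comp continuous_real_toNNReal
  have hu : Continuous u := continuous_pi fun b =>
    (ContinuousMap.evalCLM ℝ x).continuous.comp (hcont _)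
  have hgen : ∀ b : levelSet V N, restrict (generatorFun G α (monomialFun b))
      (continuous_generatorFun G α (contDiff_monomialFun (b : V → ℕ))) =
      ∑ c : levelSet V N, killedMatrix G α N b c • monomialMap (c : V → ℕ) := by
    intro b
    ext y
    rw [ContinuousMap.sum_apply]
    change generatorFun G α (monomialFun b) y = _
    rw [generatorFun_monomialFun G α (levelSet_closed b.2), ← Finset.sum_coe_sort]
    rfl
  have hode : ∀ s, 0 ≤ s → ∀ b, u s b - u 0 b =
      ∫ r in (0 : ℝ)..s, ∑ c, killedMatrix G α N b c * u r c := by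
    intro s hs b
    have h1 := congr_arg (ContinuousMap.evalCLM ℝ x)
      (hT (monomialFun (b : V → ℕ)) (contDiff_monomialFun _) s.toNNReal)
    rw [← ContinuousLinearMap.intervalIntegral_comp_comm _ ((hcont _).intervalIntegrable _ _),
      hgen, Real.coe_toNNReal s hs] at h1
    have h0 : u 0 b = monomialMap (b : V → ℕ) x := by
      simp only [u, Real.toNNReal_zero, T.op_zero]
    rw [h0]
    refine h1.trans (intervalIntegral.integral_congr fun r _ => ?_)
    simp only [map_sum, map_smul]
    rfl
  have h := congr_fun (eq_exp_smul_mulVec hu hode t.coe_nonneg) a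
  simp only [u, Real.toNNReal_coe, Real.toNNReal_zero, T.op_zero] at h
  exact h

open scoped Matrix.Norms.Operator in
theorem exists_tendsto_exp_killedMatrix [Nonempty V] {α : ℝ} (hα : 0 < α)
    {T : MarkovSemigroup (Simplex V)} (hT : IsDiffusionSemigroup G α T) {N : ℕ}
    (a : levelSet V N) :
    ∃ M : ℝ, Tendsto (fun t : ℝ≥0 => NormedSpace.exp ((t : ℝ) • killedMatrix G α N) a
        ⟨0, zero_mem_levelSet N⟩) atTop (𝓝 M) ∧
      ∀ b, b ≠ ⟨0, zero_mem_levelSet N⟩ →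
        Tendsto (fun t : ℝ≥0 => NormedSpace.exp ((t : ℝ) • killedMatrix G α N) a b) atTop
          (𝓝 0) := by
  have : Nonempty (levelSet V N) := ⟨a⟩
  obtain ⟨x⟩ : Nonempty (Simplex V) := inferInstance
  refine exists_tendsto_exp_smul (killedMatrix_nonneg G hα N)
    (z := ⟨0, zero_mem_levelSet N⟩) (fun j => killedRate_zero_left G α _)
    (fun b => ∑ i, (b : V → ℕ) i) (fun b hb => ?_)
    (C := 1) fun t => ?_
  · obtain ⟨c, hc, hpos⟩ := exists_rateMatrix_pos G hα (b := (b : V → ℕ))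
      fun h => hb (Subtype.ext h)
    refine ⟨⟨c, levelSet_closed b.2 c hc.le⟩, hc, ?_⟩
    rw [killedMatrix_apply, killedRate, if_neg, sub_zero]
    · exact hpos
    · intro h
      rw [h] at hc
      exact lt_irrefl _ hc
  · have h1 := T.op_le_one t (monomialMap_le_one (a : V → ℕ)) x
    rw [op_monomialMap G hT] at h1
    refine le_trans ?_ h1
    have h2 := Finset.single_le_sum (f := fun b : levelSet V N =>
      NormedSpace.exp ((t : ℝ) • killedMatrix G α N) a b * monomialMap (b : V → ℕ) x)
      (fun b _ => mul_nonneg (exp_smul_nonneg (killedMatrix_nonneg G hα N) t.2 _ _)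
        (monomialMap_nonneg _ _)) (Finset.mem_univ ⟨0, zero_mem_levelSet N⟩)
    simpa [monomialMap_zero] using h2

open scoped Matrix.Norms.Operator in
/-- The dual chain without killing is absorbed in `0`. -/
theorem tendsto_exp_rateMatrix {α : ℝ} (hα : 0 < α) {N : ℕ} (a : levelSet V N) :
    Tendsto (fun t : ℝ≥0 => NormedSpace.exp ((t : ℝ) • Matrix.of fun x y : levelSet V N =>
      rateMatrix G α x y) a ⟨0, zero_mem_levelSet N⟩) atTop (𝓝 1) := by
  have : Nonempty (levelSet V N) := ⟨a⟩
  set A : Matrix (levelSet V N) (levelSet V N) ℝ := Matrix.of fun x y => rateMatrix G α x y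
  have hA : ∀ i j, i ≠ j → 0 ≤ A i j := fun i j h =>
    rateMatrix_nonneg G hα.le fun h' => h (Subtype.ext h')
  have hsum : ∀ t : ℝ≥0, ∑ b, NormedSpace.exp ((t : ℝ) • A) a b = 1 := by
    -- Zero row sums mean that the constant vector `1` solves the linear system, so `exp(tA)` fixes
    -- it.
    intro t
    have h := congr_fun (eq_exp_smul_mulVec (A := A) (u := fun _ _ => 1) continuous_const
      (fun t _ i => by
        have h0 : ∑ j, A i j * 1 = 0 := by
          simp only [mul_one, A, Matrix.of_apply]
          rw [Finset.sum_coe_sort (levelSet V N) fun b => rateMatrix G α i b]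
          exact sum_rateMatrix_levelSet G α i.2
        rw [h0]; simp) t.coe_nonneg) a
    simpa [Matrix.mulVec, dotProduct] using h.symm
  obtain ⟨M, -, h0⟩ := exists_tendsto_exp_smul hA (z := ⟨0, zero_mem_levelSet N⟩) (a := a)
    (fun j => rateMatrix_zero_left G α _) (fun b => ∑ i, (b : V → ℕ) i) (fun b hb => by
      obtain ⟨c, hc, hpos⟩ := exists_rateMatrix_pos G hα (b := (b : V → ℕ))
        fun h => hb (Subtype.ext h)
      exact ⟨⟨c, levelSet_closed b.2 c hc.le⟩, hc, hpos⟩) (C := 1) (fun t => by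
      rw [← hsum t]
      exact Finset.single_le_sum (fun b _ => exp_smul_nonneg hA t.2 a b) (Finset.mem_univ _))
  have h1 : Tendsto (fun t : ℝ≥0 => 1 - ∑ b ∈ Finset.univ.erase ⟨0, zero_mem_levelSet N⟩,
      NormedSpace.exp ((t : ℝ) • A) a b) atTop (𝓝 (1 - ∑ b ∈ Finset.univ.erase
        (⟨0, zero_mem_levelSet N⟩ : levelSet V N), 0)) :=
    (tendsto_finsetSum _ fun b hb => h0 b (Finset.ne_of_mem_erase hb)).const_sub _
  rw [Finset.sum_const_zero, sub_zero] at h1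
  refine h1.congr fun t => ?_
  rw [← hsum t, ← Finset.add_sum_erase _ _ (Finset.mem_univ ⟨0, zero_mem_levelSet N⟩),
    add_sub_cancel_right]

/-- Only column `0` survives in the limit, and its monomial is the constant `1`; the dependence on
`μ` disappears. -/
theorem tendsto_moment {α : ℝ} {T : MarkovSemigroup (Simplex V)} (hT : IsDiffusionSemigroup G α T)
    {N : ℕ} (a : levelSet V N) {M : ℝ}
    (h0 : Tendsto (fun t : ℝ≥0 => NormedSpace.exp ((t : ℝ) • killedMatrix G α N) a
      ⟨0, zero_mem_levelSet N⟩) atTop (𝓝 M))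
    (h : ∀ b, b ≠ ⟨0, zero_mem_levelSet N⟩ →
      Tendsto (fun t : ℝ≥0 => NormedSpace.exp ((t : ℝ) • killedMatrix G α N) a b) atTop (𝓝 0))
    (μ : ProbabilityMeasure (Simplex V)) :
    Tendsto (fun t : ℝ≥0 => ∫ x, monomialMap (a : V → ℕ) x ∂(T.adjoint t μ : Measure (Simplex V)))
      atTop (𝓝 M) := by
  have h1 : ∀ t : ℝ≥0,
      ∑ b : levelSet V N, NormedSpace.exp ((t : ℝ) • killedMatrix G α N) a b *
        ∫ x, monomialMap (b : V → ℕ) x ∂(μ : Measure (Simplex V)) =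
      ∫ x, monomialMap (a : V → ℕ) x ∂(T.adjoint t μ : Measure (Simplex V)) := by
    intro t
    rw [T.integral_adjoint]
    simp only [op_monomialMap G hT]
    rw [integral_finsetSum _ fun b _ => (integrable_continuousMap μ _).const_mul _]
    simp only [integral_const_mul]
  have h2 : Tendsto (fun t : ℝ≥0 => ∑ b : levelSet V N,
      NormedSpace.exp ((t : ℝ) • killedMatrix G α N) a b *
      ∫ x, monomialMap (b : V → ℕ) x ∂(μ : Measure (Simplex V))) atTop
      (𝓝 (∑ b : levelSet V N, (if b = ⟨0, zero_mem_levelSet N⟩ then M else 0) *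
        ∫ x, monomialMap (b : V → ℕ) x ∂(μ : Measure (Simplex V)))) := by
    refine tendsto_finsetSum _ fun b _ => Tendsto.mul_const _ ?_
    split_ifs with hb
    · rw [hb]; exact h0
    · exact h b hb
  simp only [ite_mul, zero_mul, Finset.sum_ite_eq', Finset.mem_univ, if_true, monomialMap_zero,
    ContinuousMap.one_apply, integral_const, probReal_univ, smul_eq_mul, mul_one] at h2
  exact h2.congr h1

end LevelSet

end GraphDiffusion

end

/-! ### Existence, uniqueness, convergence and moments -/

theorem mainTheorem2 {V : Type*} [Fintype V] [DecidableEq V]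
    (G : SimpleGraph V) [DecidableRel G.Adj] (hG : G.Connected) (hr : 2 ≤ Fintype.card V)
    (α : ℝ) (hα : 0 < α)
    (T : GraphDiffusion.MarkovSemigroup (GraphDiffusion.Simplex V))
    (hT : GraphDiffusion.IsDiffusionSemigroup G α T) :
    ∃ ν : ProbabilityMeasure (GraphDiffusion.Simplex V),
      (∀ μ : ProbabilityMeasure (GraphDiffusion.Simplex V), T.IsStationary μ ↔ μ = ν) ∧
      (∀ x : GraphDiffusion.Simplex V,
        Tendsto (fun t : ℝ≥0 => T.adjoint t (diracProba x)) atTop (𝓝 ν)) ∧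
      (∀ (a : V → ℕ) (Ω : Type*) [MeasurableSpace Ω] (P : Measure Ω) [IsProbabilityMeasure P]
        (X : ℝ≥0 → Ω → (V → ℕ)),
        GraphDiffusion.IsMarkovChain (GraphDiffusion.rateMatrix G α) a P X →
        (∀ᵐ ω ∂P, GraphDiffusion.hittingTime X 0 ω < ∞) ∧
        Integrable (fun ω => Real.exp (-∫ s in (0 : ℝ)..(GraphDiffusion.hittingTime X 0 ω).toReal,
          GraphDiffusion.killingRate G α (X s.toNNReal ω))) P ∧
        ∫ x, ∏ i, (x : V → ℝ) i ^ a i ∂(ν : Measure (GraphDiffusion.Simplex V))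
          = ∫ ω, Real.exp (-∫ s in (0 : ℝ)..(GraphDiffusion.hittingTime X 0 ω).toReal,
              GraphDiffusion.killingRate G α (X s.toNNReal ω)) ∂P) := by
  open GraphDiffusion in
  have : Nonempty V := hG.nonempty
  have hmem : ∀ a : V → ℕ, a ∈ levelSet V (∑ i, a i) := fun a => mem_levelSet.2 le_rfl
  choose M hM hM0 using fun a : V → ℕ => exists_tendsto_exp_killedMatrix G hα hT ⟨a, hmem a⟩
  have hmom := fun a => tendsto_moment G hT ⟨a, hmem a⟩ (hM a) (hM0 a)
  obtain ⟨x₀⟩ : Nonempty (Simplex V) := inferInstance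
  have hlim : ∀ (μ ν : ProbabilityMeasure (Simplex V)) (U : Ultrafilter ℝ≥0),
      (U : Filter ℝ≥0) ≤ atTop →
      Tendsto (fun t : ℝ≥0 => T.adjoint t μ) U (𝓝 ν) →
      ∀ a, ∫ x, monomialMap a x ∂(ν : Measure (Simplex V)) = M a := fun μ ν U hU h a =>
    tendsto_nhds_unique (tendsto_integral_continuousMap h (monomialMap a)) ((hmom a μ).mono_left hU)
  -- Compactness of the space of probability measures gives every ultrafilter a limit; by `hlim`,
  -- limits along ultrafilters finer than `atTop` all have moments `M` and hence coincide.
  have hcpt : ∀ (μ : ProbabilityMeasure (Simplex V)) (U : Ultrafilter ℝ≥0),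
      ∃ ν, Tendsto (fun t : ℝ≥0 => T.adjoint t μ) U (𝓝 ν) := fun μ U =>
    ⟨_, (U.map fun t : ℝ≥0 => T.adjoint t μ).le_nhds_lim⟩
  obtain ⟨ν, hν⟩ := hcpt (diracProba x₀) (Ultrafilter.of atTop)
  have hνM := hlim _ _ _ (Ultrafilter.of_le _) hν
  have hconv : ∀ x : Simplex V, Tendsto (fun t : ℝ≥0 => T.adjoint t (diracProba x)) atTop (𝓝 ν) := by
    intro x
    rw [tendsto_iff_ultrafilter]
    intro U hU
    obtain ⟨ν', hν'⟩ := hcpt (diracProba x) U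
    have : ν' = ν := eq_of_forall_moment_eq fun a => by rw [hνM, hlim _ _ _ hU hν']
    rwa [← this]
  refine ⟨ν, fun μ => ⟨fun hμ => ?_, ?_⟩, hconv, ?_⟩
  · refine eq_of_forall_moment_eq fun a => ?_
    rw [hνM]
    have h := hmom a μ
    simp only [hμ _] at h
    exact tendsto_nhds_unique tendsto_const_nhds h
  · rintro rfl
    exact T.isStationary_of_tendsto (hconv x₀)
  · intro a Ω _ P _ X hX
    obtain ⟨h1, h2, h3⟩ := hX.feynmanKac_hittingTime (hmem a)
      (fun b hb => sum_rateMatrix_levelSet G α hb) (zero_mem_levelSet _)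
      (rateMatrix_zero_left G α 0) (killingRate_zero G α) (tendsto_exp_rateMatrix G hα ⟨a, hmem a⟩)
      (hM a)
    exact ⟨h1, h2, (hνM a).trans h3.symm⟩
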